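/- Consider the real, autonomous, multilinear equation on the lattice $\mathbb Z^2$ $$\begin{aligned}\mathcal Q^+ :={}& a_1(u_{n,m}+u_{n+1,m+1})+a_2(u_{n+1,m}+u_{n,m+1})\\ &+(\alpha_1-\alpha_2)u_{n,m}u_{n+1,m}+(\alpha_1+\alpha_2)u_{n,m+1}u_{n+1,m+1}\\ &+(\beta_1-\beta_2)u_{n,m}u_{n,m+1}+(\beta_1+\beta_2)u_{n+1,m}u_{n+1,m+1}\\ &+\gamma_1u_{n,m}u_{n+1,m+1}+\gamma_2u_{n+1,m}u_{n,m+1}\\ &+(\xi_1-\xi_3)u_{n,m}u_{n+1,m}u_{n,m+1}+(\xi_1+\xi_3)u_{n,m}u_{n+1,m}u_{n+1,m+1}\\ &+(\xi_2-\xi_4)u_{n+1,m}u_{n,m+1}u_{n+1,m+1}+(\xi_2+\xi_4)u_{n,m}u_{n,m+1}u_{n+1,m+1}\\ &+\zeta\,u_{n,m}u_{n+1,m}u_{n,m+1}u_{n+1,m+1}=0\end{aligned}$$ with real coefficients, $a_1,a_2\neq0$, $|a_1|\ne|a_2|$. A dispersion relation is a differentiable function $\omega:\mathbb R\to\mathbb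 R$ such that for every $k$ the wave $e^{i(kn-\omega(k)m)}$ solves the linear part. Let $K=e^{i\kappa}$, $\Omega=e^{-i\omega(\kappa)}$. Call $\kappa$ nonresonant if $\sin\kappa\neq0$ and $a_1(1+K^2\Omega^2)+a_2(K^2+\Omega^2)\ne0$. Insert the multiscale expansion $$u_{n,m}=\sum_{\ell\ge1}\varepsilon^{\ell}\sum_{|\alpha|\le\ell}K^{\alpha n}\Omega^{\alpha m}\,u^{(\alpha)}_\ell(n_1,m_1,m_2,\dots),\qquad n_1=\varepsilon n,\quad m_j=\varepsilon^jm,$$ into $\mathcal Q^+$, the shifts of the amplitudes being expanded in Taylor series in $\varepsilon$, and let $\mathcal W_j^{(\alpha)}$ be the coefficient of $\varepsilon^jK^{\alpha n}\Omega^{\alpha m}$ in the result. The amplitudes are smooth and bounded, satisfy $u_\ell^{(-\alpha)}=\overline{u_\ell^{(\alpha)}}$, and depend on $n_1,m_1$ only through $\xi=n_1-\omega'(\kappa)m_1$. One says that at $\kappa$ the equation reduces to the nonlinear Schrödinger equation (NLSE) with coefficients $\rho_1,\rho_2\in\mathbb C$ if there is a constant $c\ne0$ such that, for all such amplitudes with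 $\mathcal W_1^{(\alpha)}=\mathcal W_2^{(\alpha)}=0$ for all $\alpha$, $$\mathcal W_3^{(1)}=c\,\bigl(i\,\partial_{m_2}u+\rho_1\,\partial_\xi^2u+\rho_2\,u|u|^2\bigr),\qquad u=u_1^{(1)}.$$ The equation passes the $A_1$ test if, for every dispersion relation and every nonresonant $\kappa$, it reduces to an NLSE with real $\rho_1,\rho_2$. Consider the six families of conditions: (S1) $\alpha_2=\beta_2=0$, $\xi_1=\xi_2$, $\xi_3=\xi_4$. (S2) $\alpha_2=\beta_2$, $\alpha_1=\beta_1$, $a_1=2a_2$, $\gamma_1=2\gamma_2$, $a_1(\xi_1-\xi_2)=-a_1(\xi_3-\xi_4)=-2\alpha_2\gamma_2$. (S3) $\alpha_2=-\beta_2$, $\alpha_1=\beta_1$, $a_2=2a_1$, $\gamma_2=2\gamma_1$, $a_1(\xi_1-\xi_2)=a_1(\xi_3-\xi_4)=-\alpha_2\gamma_1$. (S4) $a_2\alpha_1=a_2\beta_1=\frac12(a_1+a_2)\gamma_2$, $a_2\gamma_1=a_1\gamma_2$, $a_1(\xi_1-\xi_2)=-\alpha_2\gamma_1$, $a_1(\xi_3-\xi_4)=\beta_2\gamma_1$.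 (S5) $(a_2-a_1)\beta_2=(a_2+a_1)\alpha_2$, $2a_1a_2(a_1-a_2)\alpha_1=(a_1+a_2)(\gamma_2a_1^2-\gamma_1a_2^2)$, $2a_1a_2\beta_1=\gamma_1a_2^2+\gamma_2a_1^2$, $(a_2-a_1)(\xi_1-\xi_2)=(\gamma_1-\gamma_2)\alpha_2$, $(a_2-a_1)^2(\xi_3-\xi_4)=[\gamma_2(a_2-3a_1)-\gamma_1(a_1-3a_2)]\alpha_2$. (S6) $(a_2+a_1)\beta_2=(a_2-a_1)\alpha_2$, $2a_1a_2\alpha_1=\gamma_1a_2^2+\gamma_2a_1^2$, $2a_1a_2(a_1-a_2)\beta_1=(a_1+a_2)(\gamma_2a_1^2-\gamma_1a_2^2)$, $(a_2^2-a_1^2)(\xi_1-\xi_2)=[\gamma_1(a_1-3a_2)-\gamma_2(a_2-3a_1)]\alpha_2$, $(a_1+a_2)(\xi_3-\xi_4)=(\gamma_2-\gamma_1)\alpha_2$. **Statement.** If the coefficients satisfy none of (S1)–(S6), then $\mathcal Q^+$ is not integrable, in the sense that it fails the $A_1$ test: for every dispersion relation and every nonresonant $\kappa$ the equation reduces to an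 NLSE with uniquely determined coefficients $\rho_1,\rho_2\in\mathbb C$, but not for all of them are both coefficients real. -/

import Mathlib

open scoped LaurentPolynomial ComplexConjugate

noncomputable section

namespace QPlus

/-- The 13 real coefficients of an equation of the class `Q⁺`. -/
structure Coeffs where
  a₁ : ℝ
  a₂ : ℝ
  α₁ : ℝ
  α₂ : ℝ
  β₁ : ℝ
  β₂ : ℝ
  γ₁ : ℝ
  γ₂ : ℝ
  ξ₁ : ℝ
  ξ₂ : ℝ
  ξ₃ : ℝ
  ξ₄ : ℝ
  ζ : ℝ

/-- The multilinear polynomial `Q⁺` evaluated at `u₀₀ = u_{n,m}`, `u₁₀ = u_{n+1,m}`,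
`u₀₁ = u_{n,m+1}`, `u₁₁ = u_{n+1,m+1}`, in any commutative real algebra. -/
def Q (P : Coeffs) {R : Type*} [CommRing R] [Algebra ℝ R] (u₀₀ u₁₀ u₀₁ u₁₁ : R) : R :=
  P.a₁ • (u₀₀ + u₁₁) + P.a₂ • (u₁₀ + u₀₁)
    + (P.α₁ - P.α₂) • (u₀₀ * u₁₀) + (P.α₁ + P.α₂) • (u₀₁ * u₁₁)
    + (P.β₁ - P.β₂) • (u₀₀ * u₀₁) + (P.β₁ + P.β₂) • (u₁₀ * u₁₁)
    + P.γ₁ • (u₀₀ * u₁₁) + P.γ₂ • (u₁₀ * u₀₁)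
    + (P.ξ₁ - P.ξ₃) • (u₀₀ * u₁₀ * u₀₁) + (P.ξ₁ + P.ξ₃) • (u₀₀ * u₁₀ * u₁₁)
    + (P.ξ₂ - P.ξ₄) • (u₁₀ * u₀₁ * u₁₁) + (P.ξ₂ + P.ξ₄) • (u₀₀ * u₀₁ * u₁₁)
    + P.ζ • (u₀₀ * u₁₀ * u₀₁ * u₁₁)

/-- Symbol of the linear part of `Q⁺`: its value on `u_{n,m} = Kⁿ Ωᵐ`, divided by `Kⁿ Ωᵐ`. -/
def linSymbol (P : Coeffs) (K Ω : ℂ) : ℂ :=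
  P.a₁ * (1 + K * Ω) + P.a₂ * (K + Ω)

/-- The wave factor `K = e^{iκ}`. -/
def waveK (κ : ℝ) : ℂ := Complex.exp (Complex.I * (κ : ℂ))

/-- The wave factor `Ω = e^{-iω(κ)}`. -/
def waveΩ (ω : ℝ → ℝ) (κ : ℝ) : ℂ := Complex.exp (-(Complex.I * (ω κ : ℂ)))

/-- `ω` is a (real, differentiable) dispersion relation of `Q⁺`: for every wave number `k`
the wave `e^{i(k n - ω(k) m)}` solves the linear part of the equation. -/
def IsDispersionRelation (P : Coeffs) (ω : ℝ → ℝ) : Prop :=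
  Differentiable ℝ ω ∧ ∀ k : ℝ, linSymbol P (waveK k) (waveΩ ω k) = 0

/-! ### The multiscale expansion up to order `ε³` -/

/-- The slow variables `(n₁, m₁, m₂)`. The slow times `m₃, m₄, …` do not occur
up to order `ε³`. -/
abbrev Slow : Type := ℝ × ℝ × ℝ

/-- Derivative of a function of the slow variables along the direction `v`. -/
def D (v : Slow) (f : Slow → ℂ) : Slow → ℂ := fun p => fderiv ℝ f p v

/-- `∂/∂n₁` -/
def δn₁ : (Slow → ℂ) → Slow → ℂ := D (1, 0, 0)

/-- `∂/∂m₁` -/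
def δm₁ : (Slow → ℂ) → Slow → ℂ := D (0, 1, 0)

/-- `∂/∂m₂` -/
def δm₂ : (Slow → ℂ) → Slow → ℂ := D (0, 0, 1)

/-- The operator multiplying `εⁱ` in the Taylor expansion of
`f (n₁ + s ε, m₁ + t ε, m₂ + t ε²)`, for `i ≤ 2`. For `(s, t) = (1,0), (0,1), (1,1)` these are
the operators `𝒜ᵢ, ℬᵢ, 𝒞ᵢ` describing the shifts `n → n+1`, `m → m+1` and both.
Only the orders `i ≤ 2` enter below. -/
def shiftOp (s t : ℕ) : ℕ → (Slow → ℂ) → Slow → ℂ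
  | 0, f => f
  | 1, f => fun p => (s : ℂ) * δn₁ f p + (t : ℂ) * δm₁ f p
  | 2, f => fun p =>
      (1 / 2 : ℂ) * ((s : ℂ) * δn₁ (fun q => (s : ℂ) * δn₁ f q + (t : ℂ) * δm₁ f q) p
        + (t : ℂ) * δm₁ (fun q => (s : ℂ) * δn₁ f q + (t : ℂ) * δm₁ f q) p)
      + (t : ℂ) * δm₂ f p
  | _ + 3, _ => 0

/-- The expansion of `u_{n+s,m+t}` (`s, t ∈ {0,1}`) up to order `ε³`, at the slow point `p`:
a power series in `ε` whose coefficients are Laurent polynomials in the harmonic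
`T = Kⁿ Ωᵐ`. Here `u ℓ α` is the amplitude `u_ℓ^{(α)}`, `|α| ≤ ℓ`, and
`u_{n,m} = ∑_{ℓ ≥ 1} ε^ℓ ∑_{|α| ≤ ℓ} K^{αn} Ω^{αm} u_ℓ^{(α)}`. -/
def field (ω : ℝ → ℝ) (κ : ℝ) (u : ℕ → ℤ → Slow → ℂ) (s t : ℕ) (p : Slow) :
    PowerSeries ℂ[T;T⁻¹] :=
  PowerSeries.mk fun ℓ =>
    if ℓ ≤ 3 then
      ∑ α ∈ Finset.Icc (-(ℓ : ℤ)) (ℓ : ℤ),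
        LaurentPolynomial.C (waveK κ ^ ((s : ℤ) * α) * waveΩ ω κ ^ ((t : ℤ) * α) *
          ∑ j ∈ Finset.Icc (max 1 α.natAbs) ℓ, shiftOp s t (ℓ - j) (u j α) p)
          * LaurentPolynomial.T α
    else 0

/-- `𝒲_j^{(α)}`, for `j ≤ 3`: the coefficient of `ε^j K^{αn} Ω^{αm}` in `Q⁺` after
substitution of the multiscale expansion. -/
def W (P : Coeffs) (ω : ℝ → ℝ) (κ : ℝ) (u : ℕ → ℤ → Slow → ℂ) (j : ℕ) (α : ℤ)
    (p : Slow) : ℂ :=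
  (PowerSeries.coeff j
    (Q P (field ω κ u 0 0 p) (field ω κ u 1 0 p) (field ω κ u 0 1 p) (field ω κ u 1 1 p))).coeff α

/-- Admissible families of amplitudes: smooth bounded functions of the slow variables, with
`u_ℓ^{(-α)}` conjugate to `u_ℓ^{(α)}` (the solution is real), which depend on `n₁` and `m₁` only
through `ξ = n₁ - ω'(κ) m₁`. -/
structure IsAmplitudeFamily (ω : ℝ → ℝ) (κ : ℝ) (u : ℕ → ℤ → Slow → ℂ) : Prop where
  smooth : ∀ ℓ α, ContDiff ℝ (⊤ : ℕ∞) (u ℓ α)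
  bounded : ∀ ℓ α, ∃ M : ℝ, ∀ p, ‖u ℓ α p‖ ≤ M
  real : ∀ ℓ α p, u ℓ (-α) p = conj (u ℓ α p)
  travelling : ∀ ℓ α n₁ m₁ m₂, u ℓ α (n₁, m₁, m₂) = u ℓ α (n₁ - deriv ω κ * m₁, 0, m₂)

/-- At the wave number `κ` the multiscale reduction of `Q⁺` at order `ε³` is the nonlinear
Schrödinger equation `i ∂_{m₂} u + ρ₁ ∂_ξ² u + ρ₂ u |u|² = 0` for `u = u₁^{(1)}`: modulo the
equations of order `ε` and `ε²`, the expression `𝒲₃^{(1)}` is a nonzero constant multiple of the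
left-hand side. On functions of `(ξ, m₂)` the derivative `∂_ξ` is `∂_{n₁}`. -/
def ReducesToNLS (P : Coeffs) (ω : ℝ → ℝ) (κ : ℝ) (ρ₁ ρ₂ : ℂ) : Prop :=
  ∃ c : ℂ, c ≠ 0 ∧ ∀ u : ℕ → ℤ → Slow → ℂ, IsAmplitudeFamily ω κ u →
    (∀ α p, W P ω κ u 1 α p = 0) → (∀ α p, W P ω κ u 2 α p = 0) →
    ∀ p, W P ω κ u 3 1 p =
      c * (Complex.I * δm₂ (u 1 1) p + ρ₁ * δn₁ (δn₁ (u 1 1)) p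
        + ρ₂ * (u 1 1 p * (‖u 1 1 p‖ : ℂ) ^ 2))

/-- Wave numbers at which the expansion is nondegenerate: `sin κ ≠ 0` (otherwise the dispersion
coefficient `ω''(κ)/2` vanishes) and the second harmonic is not itself a linear wave, so that
`u₂^{(2)}` is determined by `u₁^{(1)}`. -/
def IsNonresonant (P : Coeffs) (ω : ℝ → ℝ) (κ : ℝ) : Prop :=
  Real.sin κ ≠ 0 ∧ linSymbol P (waveK κ ^ 2) (waveΩ ω κ ^ 2) ≠ 0

/-- The `A₁` test: at every nonresonant wave number the reduction at order `ε³` is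
a nonlinear Schrödinger equation with real coefficients. -/
def IsA₁Integrable (P : Coeffs) : Prop :=
  ∀ ω : ℝ → ℝ, IsDispersionRelation P ω → ∀ κ : ℝ, IsNonresonant P ω κ →
    ∃ ρ₁ ρ₂ : ℝ, ReducesToNLS P ω κ ρ₁ ρ₂

/-! ### The six families -/

def S1 (P : Coeffs) : Prop :=
  P.α₂ = 0 ∧ P.β₂ = 0 ∧ P.ξ₁ = P.ξ₂ ∧ P.ξ₃ = P.ξ₄

def S2 (P : Coeffs) : Prop :=
  P.α₂ = P.β₂ ∧ P.α₁ = P.β₁ ∧ P.a₁ = 2 * P.a₂ ∧ P.γ₁ = 2 * P.γ₂ ∧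
    P.a₁ * (P.ξ₁ - P.ξ₂) = -2 * P.α₂ * P.γ₂ ∧
    -P.a₁ * (P.ξ₃ - P.ξ₄) = -2 * P.α₂ * P.γ₂

def S3 (P : Coeffs) : Prop :=
  P.α₂ = -P.β₂ ∧ P.α₁ = P.β₁ ∧ P.a₂ = 2 * P.a₁ ∧ P.γ₂ = 2 * P.γ₁ ∧
    P.a₁ * (P.ξ₁ - P.ξ₂) = -P.α₂ * P.γ₁ ∧
    P.a₁ * (P.ξ₃ - P.ξ₄) = -P.α₂ * P.γ₁

def S4 (P : Coeffs) : Prop :=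
  P.a₂ * P.α₁ = (P.a₁ + P.a₂) * P.γ₂ / 2 ∧ P.a₂ * P.β₁ = (P.a₁ + P.a₂) * P.γ₂ / 2 ∧
    P.a₂ * P.γ₁ = P.a₁ * P.γ₂ ∧
    P.a₁ * (P.ξ₁ - P.ξ₂) = -P.α₂ * P.γ₁ ∧
    P.a₁ * (P.ξ₃ - P.ξ₄) = P.β₂ * P.γ₁

def S5 (P : Coeffs) : Prop :=
  (P.a₂ - P.a₁) * P.β₂ = (P.a₂ + P.a₁) * P.α₂ ∧
    2 * P.a₁ * P.a₂ * (P.a₁ - P.a₂) * P.α₁ =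
      (P.a₁ + P.a₂) * (P.γ₂ * P.a₁ ^ 2 - P.γ₁ * P.a₂ ^ 2) ∧
    2 * P.a₁ * P.a₂ * P.β₁ = P.γ₁ * P.a₂ ^ 2 + P.γ₂ * P.a₁ ^ 2 ∧
    (P.a₂ - P.a₁) * (P.ξ₁ - P.ξ₂) = (P.γ₁ - P.γ₂) * P.α₂ ∧
    (P.a₂ - P.a₁) ^ 2 * (P.ξ₃ - P.ξ₄) =
      (P.γ₂ * (P.a₂ - 3 * P.a₁) - P.γ₁ * (P.a₁ - 3 * P.a₂)) * P.α₂

def S6 (P : Coeffs) : Prop :=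
  (P.a₂ + P.a₁) * P.β₂ = (P.a₂ - P.a₁) * P.α₂ ∧
    2 * P.a₁ * P.a₂ * P.α₁ = P.γ₁ * P.a₂ ^ 2 + P.γ₂ * P.a₁ ^ 2 ∧
    2 * P.a₁ * P.a₂ * (P.a₁ - P.a₂) * P.β₁ =
      (P.a₁ + P.a₂) * (P.γ₂ * P.a₁ ^ 2 - P.γ₁ * P.a₂ ^ 2) ∧
    (P.a₂ ^ 2 - P.a₁ ^ 2) * (P.ξ₁ - P.ξ₂) =
      (P.γ₁ * (P.a₁ - 3 * P.a₂) - P.γ₂ * (P.a₂ - 3 * P.a₁)) * P.α₂ ∧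
    (P.a₁ + P.a₂) * (P.ξ₃ - P.ξ₄) = (P.γ₂ - P.γ₁) * P.α₂

end QPlus

end

/-!
The shift `(s, t)` acts on the harmonic `K^{αn} Ω^{αm}` by the factor `K^{sα} Ω^{tα}`, so collecting
powers of `ε` turns `𝒲_j^{(α)}` into symbols of the linear, quadratic and cubic parts of `Q⁺`. At
order `ε²` the mean field and the second harmonic are slaved to `u = u₁^{(1)}`; the dispersion
relation and its derivative remove the secular terms at order `ε³`, and what is left is an NLSE.
Evaluating it on plane waves determines `ρ₁` and `ρ₂`.

For the reality of `ρ₂`, write `K = k²`, `Ω = v²`. After division by the phase `kv` of the midpoint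
of the elementary square, the terms of `Q⁺` that are even (odd) under point reflection of the square
contribute the real (imaginary) parts of the symbols. With `a₁ = l (r + 1)`, `a₂ = l (r - 1)` and
`t = tan (κ / 2)`, the dispersion relation says that `k` and `v` point along `1 + i t` and
`t + i r`, so `Im ρ₂` is, up to a nonzero factor, a polynomial of degree five in `t²`. An explicit
dispersion relation exists and all large `t` are nonresonant, so real `ρ₂` forces its six
coefficients to vanish; solving these six equations leads to one of the six families.
-/

noncomputable section

namespace QPlus

/-! ### The homogeneous parts of the equation -/

section HomogeneousParts

variable {M : Type*} [AddCommGroup M] [Module ℝ M] (P : Coeffs)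

/-- The linear part of `Q⁺`, as a function of the values `x s t` at the corners `(s, t)`. -/
def linPart (x : ℕ → ℕ → M) : M := P.a₁ • (x 0 0 + x 1 1) + P.a₂ • (x 1 0 + x 0 1)

/-- The quadratic part of `Q⁺`, with `y s t s' t'` standing for the product of the values at the
corners `(s, t)` and `(s', t')`. -/
def quadPart (y : ℕ → ℕ → ℕ → ℕ → M) : M :=
  (P.α₁ - P.α₂) • y 0 0 1 0 + (P.α₁ + P.α₂) • y 0 1 1 1 + (P.β₁ - P.β₂) • y 0 0 0 1
    + (P.β₁ + P.β₂) • y 1 0 1 1 + P.γ₁ • y 0 0 1 1 + P.γ₂ • y 1 0 0 1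

/-- The cubic part of `Q⁺`, with `z s t s' t' s'' t''` standing for the product of the values at
the corners `(s, t)`, `(s', t')` and `(s'', t'')`. -/
def cubPart (z : ℕ → ℕ → ℕ → ℕ → ℕ → ℕ → M) : M :=
  (P.ξ₁ - P.ξ₃) • z 0 0 1 0 0 1 + (P.ξ₁ + P.ξ₃) • z 0 0 1 0 1 1
    + (P.ξ₂ - P.ξ₄) • z 1 0 0 1 1 1 + (P.ξ₂ + P.ξ₄) • z 0 0 0 1 1 1

end HomogeneousParts

section PowerSeries

variable {R : Type*} [CommRing R] {f g : PowerSeries R}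

lemma coeff_one_mul_of_coeff_zero (hf : f.coeff 0 = 0) (hg : g.coeff 0 = 0) :
    (f * g).coeff 1 = 0 := by
  simp [PowerSeries.coeff_mul, Finset.Nat.antidiagonal_succ, hf, hg]

lemma coeff_two_mul_of_coeff_zero (hf : f.coeff 0 = 0) (hg : g.coeff 0 = 0) :
    (f * g).coeff 2 = f.coeff 1 * g.coeff 1 := by
  simp [PowerSeries.coeff_mul, Finset.Nat.antidiagonal_succ, hf, hg]

lemma coeff_three_mul_of_coeff_zero (hf : f.coeff 0 = 0) (hg : g.coeff 0 = 0) :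
    (f * g).coeff 3 = f.coeff 1 * g.coeff 2 + f.coeff 2 * g.coeff 1 := by
  simp [PowerSeries.coeff_mul, Finset.Nat.antidiagonal_succ, hf, hg]

lemma coeff_zero_mul_of_coeff_zero (hf : f.coeff 0 = 0) : (f * g).coeff 0 = 0 := by
  simp [PowerSeries.coeff_mul, hf]

variable [Algebra ℝ R] (P : Coeffs) {F : ℕ → ℕ → PowerSeries R}

lemma coeff_one_Q (h : ∀ s t, (F s t).coeff 0 = 0) :
    (Q P (F 0 0) (F 1 0) (F 0 1) (F 1 1)).coeff 1 = linPart P fun s t => (F s t).coeff 1 := by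
  have h₂ s t s' t' : (F s t * F s' t').coeff 0 = 0 := coeff_zero_mul_of_coeff_zero (h s t)
  simp only [Q, map_add, PowerSeries.coeff_smul, coeff_one_mul_of_coeff_zero,
    coeff_zero_mul_of_coeff_zero, h, h₂, smul_zero, add_zero, linPart]

lemma coeff_two_Q (h : ∀ s t, (F s t).coeff 0 = 0) :
    (Q P (F 0 0) (F 1 0) (F 0 1) (F 1 1)).coeff 2 = (linPart P fun s t => (F s t).coeff 2)
      + quadPart P fun s t s' t' => (F s t).coeff 1 * (F s' t').coeff 1 := by
  have h₂ s t s' t' : (F s t * F s' t').coeff 0 = 0 := coeff_zero_mul_of_coeff_zero (h s t)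
  simp only [Q, map_add, PowerSeries.coeff_smul, coeff_one_mul_of_coeff_zero,
    coeff_zero_mul_of_coeff_zero, coeff_two_mul_of_coeff_zero, h, h₂, zero_mul, smul_zero, add_zero,
    linPart, quadPart]
  abel

lemma coeff_three_Q (h : ∀ s t, (F s t).coeff 0 = 0) :
    (Q P (F 0 0) (F 1 0) (F 0 1) (F 1 1)).coeff 3 = (linPart P fun s t => (F s t).coeff 3)
      + (quadPart P fun s t s' t' =>
          (F s t).coeff 1 * (F s' t').coeff 2 + (F s t).coeff 2 * (F s' t').coeff 1)
      + cubPart P fun s t s' t' s'' t'' =>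
          (F s t).coeff 1 * (F s' t').coeff 1 * (F s'' t'').coeff 1 := by
  have h₂ s t s' t' : (F s t * F s' t').coeff 0 = 0 := coeff_zero_mul_of_coeff_zero (h s t)
  simp only [Q, map_add, PowerSeries.coeff_smul, coeff_one_mul_of_coeff_zero,
    coeff_zero_mul_of_coeff_zero, coeff_two_mul_of_coeff_zero, coeff_three_mul_of_coeff_zero, h, h₂,
    zero_mul, smul_zero, add_zero, zero_add, linPart, quadPart, cubPart]
  abel

end PowerSeries

/-! ### Harmonics -/

section Harmonics

/-- The Laurent polynomial `∑_{|α| ≤ N} c α T^α`. -/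
def harmonics (N : ℕ) (c : ℤ → ℂ) : ℂ[T;T⁻¹] :=
  ∑ α ∈ Finset.Icc (-(N : ℤ)) N, AddMonoidAlgebra.single α (c α)

lemma coeff_harmonics (N : ℕ) (c : ℤ → ℂ) (γ : ℤ) :
    (harmonics N c).coeff γ = if γ.natAbs ≤ N then c γ else 0 := by
  have hγ : γ ∈ Finset.Icc (-(N : ℤ)) N ↔ γ.natAbs ≤ N := by rw [Finset.mem_Icc]; omega
  rw [harmonics, AddMonoidAlgebra.coeff_sum, Finsupp.finsetSum_apply]
  simp only [AddMonoidAlgebra.coeff_single, Finsupp.single_apply, Finset.sum_ite_eq', hγ]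

lemma coeff_harmonics_one_mul {c : ℤ → ℂ} (hc : c 0 = 0) (f : ℂ[T;T⁻¹]) (γ : ℤ) :
    (harmonics 1 c * f).coeff γ = c 1 * f.coeff (γ - 1) + c (-1) * f.coeff (γ + 1) := by
  have h : harmonics 1 c =
      AddMonoidAlgebra.single 1 (c 1) + AddMonoidAlgebra.single (-1) (c (-1)) := by
    rw [harmonics, show Finset.Icc (-((1 : ℕ) : ℤ)) (1 : ℕ) = {-1, 0, 1} by decide]
    simp [hc, add_comm, -LaurentPolynomial.single_eq_C_mul_T]
  rw [h, add_mul, AddMonoidAlgebra.coeff_add, Finsupp.add_apply]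
  simp only [AddMonoidAlgebra.coeff_single_mul_apply]
  congr 3 <;> ring_nf

end Harmonics

/-! ### The expansion of the equation -/

section Expansion

/-- The coefficient of `ε^ℓ T^α` in the expansion of `u_{n+s,m+t}` at the slow point `p`. -/
def amp (ω : ℝ → ℝ) (κ : ℝ) (u : ℕ → ℤ → Slow → ℂ) (p : Slow) (ℓ s t : ℕ) (α : ℤ) : ℂ :=
  waveK κ ^ ((s : ℤ) * α) * waveΩ ω κ ^ ((t : ℤ) * α) *
    ∑ j ∈ Finset.Icc (max 1 α.natAbs) ℓ, shiftOp s t (ℓ - j) (u j α) p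

variable (P : Coeffs) (ω : ℝ → ℝ) (κ : ℝ) (u : ℕ → ℤ → Slow → ℂ) (p : Slow)

lemma coeff_field (s t : ℕ) {ℓ : ℕ} (hℓ : ℓ ≤ 3) :
    (field ω κ u s t p).coeff ℓ = harmonics ℓ (amp ω κ u p ℓ s t) := by
  simp only [field, PowerSeries.coeff_mk, if_pos hℓ, harmonics, amp,
    LaurentPolynomial.single_eq_C_mul_T]

lemma coeff_zero_field (s t : ℕ) : (field ω κ u s t p).coeff 0 = 0 := by
  rw [coeff_field ω κ u p s t (Nat.zero_le 3)]
  simp [harmonics, amp]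

lemma W_one (α : ℤ) :
    W P ω κ u 1 α p = linPart P fun s t => (harmonics 1 (amp ω κ u p 1 s t)).coeff α := by
  rw [W, coeff_one_Q P (coeff_zero_field ω κ u p)]
  simp only [coeff_field ω κ u p _ _ (show 1 ≤ 3 by simp)]
  simp [linPart]

lemma W_two (α : ℤ) :
    W P ω κ u 2 α p = (linPart P fun s t => (harmonics 2 (amp ω κ u p 2 s t)).coeff α)
      + quadPart P fun s t s' t' =>
        (harmonics 1 (amp ω κ u p 1 s t) * harmonics 1 (amp ω κ u p 1 s' t')).coeff α := by
  rw [W, coeff_two_Q P (coeff_zero_field ω κ u p)]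
  simp only [coeff_field ω κ u p _ _ (show 1 ≤ 3 by simp),
    coeff_field ω κ u p _ _ (show 2 ≤ 3 by simp)]
  simp [linPart, quadPart]

lemma W_three (α : ℤ) :
    W P ω κ u 3 α p = (linPart P fun s t => (harmonics 3 (amp ω κ u p 3 s t)).coeff α)
      + (quadPart P fun s t s' t' =>
        (harmonics 1 (amp ω κ u p 1 s t) * harmonics 2 (amp ω κ u p 2 s' t')).coeff α
        + (harmonics 2 (amp ω κ u p 2 s t) * harmonics 1 (amp ω κ u p 1 s' t')).coeff α)
      + cubPart P fun s t s' t' s'' t'' =>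
        (harmonics 1 (amp ω κ u p 1 s t) * harmonics 1 (amp ω κ u p 1 s' t')
          * harmonics 1 (amp ω κ u p 1 s'' t'')).coeff α := by
  rw [W, coeff_three_Q P (coeff_zero_field ω κ u p)]
  simp only [coeff_field ω κ u p _ _ (show 1 ≤ 3 by simp),
    coeff_field ω κ u p _ _ (show 2 ≤ 3 by simp), coeff_field ω κ u p _ _ (show 3 ≤ 3 by simp)]
  simp [linPart, quadPart, cubPart]

end Expansion

/-! ### Functions of the travelling variable -/

section Travelling

/-- The projection `(n₁, m₁, m₂) ↦ (n₁ - v m₁, 0, m₂)`. -/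
def toFrame (v : ℝ) : Slow →L[ℝ] Slow :=
  (ContinuousLinearMap.fst ℝ ℝ (ℝ × ℝ)
      - v • (ContinuousLinearMap.fst ℝ ℝ ℝ).comp (ContinuousLinearMap.snd ℝ ℝ (ℝ × ℝ))).prod
    ((0 : Slow →L[ℝ] ℝ).prod
      ((ContinuousLinearMap.snd ℝ ℝ ℝ).comp (ContinuousLinearMap.snd ℝ ℝ (ℝ × ℝ))))

lemma toFrame_apply (v : ℝ) (p : Slow) : toFrame v p = (p.1 - v * p.2.1, 0, p.2.2) := by
  simp [toFrame]

/-- `f` depends on `n₁, m₁` only through `n₁ - v m₁`. -/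
def IsTravelling (v : ℝ) (f : Slow → ℂ) : Prop := ∀ p, f p = f (toFrame v p)

variable {v : ℝ} {f : Slow → ℂ}

lemma IsTravelling.D_eq (h : IsTravelling v f) (hf : Differentiable ℝ f) (w p : Slow) :
    D w f p = D (toFrame v w) f (toFrame v p) := by
  have e : f = f ∘ toFrame v := funext h
  have h1 : fderiv ℝ f p = (fderiv ℝ f (toFrame v p)).comp (toFrame v) := by
    conv_lhs => rw [e]
    rw [fderiv_comp p (hf _) (toFrame v).differentiableAt, ContinuousLinearMap.fderiv]
  simp only [D, h1, ContinuousLinearMap.comp_apply]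

lemma IsTravelling.δn₁ (h : IsTravelling v f) (hf : Differentiable ℝ f) :
    IsTravelling v (QPlus.δn₁ f) := by
  intro p
  have := h.D_eq hf (1, 0, 0) p
  rw [toFrame_apply v (1, 0, 0)] at this
  simpa [QPlus.δn₁] using this

lemma IsTravelling.δm₁_eq (h : IsTravelling v f) (hf : Differentiable ℝ f) (p : Slow) :
    δm₁ f p = -v * QPlus.δn₁ f p := by
  have h1 : δm₁ f p = D (-v, 0, 0) f (toFrame v p) := by
    have := h.D_eq hf (0, 1, 0) p
    rw [toFrame_apply v (0, 1, 0)] at this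
    simpa [δm₁] using this
  have h2 : ((-v, 0, 0) : Slow) = (-v) • (1, 0, 0) := by simp
  rw [h1, h.δn₁ hf p, h2]
  simp only [D, QPlus.δn₁, map_smul]
  simp

lemma contDiff_D (hf : ContDiff ℝ (⊤ : ℕ∞) f) (w : Slow) : ContDiff ℝ (⊤ : ℕ∞) (D w f) :=
  (hf.fderiv_right (m := (⊤ : ℕ∞)) (by simp)).clm_apply contDiff_const

lemma differentiable_of_smooth (hf : ContDiff ℝ (⊤ : ℕ∞) f) : Differentiable ℝ f :=
  hf.differentiable (by simp)

lemma D_const_mul (hf : Differentiable ℝ f) (c : ℂ) (w p : Slow) :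
    D w (fun q => c * f q) p = c * D w f p := by
  simp [D, fderiv_const_mul (hf p)]

lemma shiftOp_one_eq (h : IsTravelling v f) (hf : Differentiable ℝ f) (s t : ℕ) (p : Slow) :
    shiftOp s t 1 f p = (s - t * v) * δn₁ f p := by
  simp only [shiftOp, h.δm₁_eq hf]
  ring

lemma shiftOp_two_eq (h : IsTravelling v f) (hf : ContDiff ℝ (⊤ : ℕ∞) f) (s t : ℕ) (p : Slow) :
    shiftOp s t 2 f p = 1 / 2 * (s - t * v) ^ 2 * δn₁ (δn₁ f) p + t * δm₂ f p := by
  have hd := differentiable_of_smooth hf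
  have hd' : Differentiable ℝ (δn₁ f) := differentiable_of_smooth (contDiff_D hf _)
  have e : (fun q => (s : ℂ) * δn₁ f q + (t : ℂ) * δm₁ f q)
      = fun q => ((s : ℂ) - t * v) * δn₁ f q := by
    funext q
    rw [h.δm₁_eq hd]
    ring
  have e1 : ∀ c : ℂ, δn₁ (fun q => c * δn₁ f q) p = c * δn₁ (δn₁ f) p :=
    fun c => D_const_mul hd' c _ p
  have e2 : ∀ c : ℂ, δm₁ (fun q => c * δn₁ f q) p = c * δm₁ (δn₁ f) p :=
    fun c => D_const_mul hd' c _ p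
  simp only [shiftOp]
  rw [e, e1, e2, (h.δn₁ hd).δm₁_eq hd']
  ring

end Travelling

/-! ### Symbols -/

section Symbols

variable (P : Coeffs) (K Ω : ℂ)

/-- The harmonic `K^{αn} Ω^{αm}` at the corner `(n, m) = (s, t)`. -/
def wave (α : ℤ) (s t : ℕ) : ℂ := K ^ ((s : ℤ) * α) * Ω ^ ((t : ℤ) * α)

/-- The `j`-th moment of the linear part on the harmonic `α`: the symbol by which `∂_ξ^j` acts,
up to the factor `1 / j!`, on amplitudes travelling with velocity `v`. -/
def linMoment (v : ℝ) (j : ℕ) (α : ℤ) : ℂ :=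
  linPart P fun s t => wave K Ω α s t * ((s : ℂ) - t * v) ^ j

/-- The symbol by which `∂_{m₂}` acts on the first harmonic. -/
def timeSymbol : ℂ := linPart P fun s t => wave K Ω 1 s t * t

/-- The symbol of the quadratic interaction of the harmonics `α` and `β`. For `α = β` it counts
each product twice. -/
def quadSymbol (α β : ℤ) : ℂ :=
  quadPart P fun s t s' t' =>
    wave K Ω α s t * wave K Ω β s' t' + wave K Ω β s t * wave K Ω α s' t'

/-- The symbol of the cubic interaction of the harmonics `1`, `1` and `-1`. -/
def cubSymbol : ℂ :=
  cubPart P fun s t s' t' s'' t'' =>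
    wave K Ω (-1) s t * wave K Ω 1 s' t' * wave K Ω 1 s'' t''
      + wave K Ω 1 s t * wave K Ω (-1) s' t' * wave K Ω 1 s'' t''
      + wave K Ω 1 s t * wave K Ω 1 s' t' * wave K Ω (-1) s'' t''

variable {P K Ω}

lemma linMoment_zero (v : ℝ) (α : ℤ) : linMoment P K Ω v 0 α = linSymbol P (K ^ α) (Ω ^ α) := by
  simp [linMoment, linPart, wave, linSymbol, mul_add]

lemma quadSymbol_comm (α β : ℤ) : quadSymbol P K Ω α β = quadSymbol P K Ω β α := by
  simp only [quadSymbol, add_comm]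

section Conj

variable (hK : conj K = K⁻¹) (hΩ : conj Ω = Ω⁻¹)
include hK hΩ

lemma conj_wave (α : ℤ) (s t : ℕ) : conj (wave K Ω α s t) = wave K Ω (-α) s t := by
  simp [wave, hK, hΩ]

lemma conj_linMoment (v : ℝ) (j : ℕ) (α : ℤ) :
    conj (linMoment P K Ω v j α) = linMoment P K Ω v j (-α) := by
  simp [linMoment, linPart, conj_wave hK hΩ]

lemma conj_quadSymbol (α β : ℤ) :
    conj (quadSymbol P K Ω α β) = quadSymbol P K Ω (-α) (-β) := by
  simp [quadSymbol, quadPart, conj_wave hK hΩ]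

end Conj

end Symbols

/-! ### The equations of order `ε`, `ε²`, `ε³` -/

section OrderEquations

variable {P : Coeffs} {ω : ℝ → ℝ} {κ : ℝ} {u : ℕ → ℤ → Slow → ℂ}

lemma IsAmplitudeFamily.isTravelling (h : IsAmplitudeFamily ω κ u) (ℓ : ℕ) (α : ℤ) :
    IsTravelling (deriv ω κ) (u ℓ α) := by
  rintro ⟨n, m, l⟩
  rw [h.travelling, toFrame_apply]

lemma IsAmplitudeFamily.differentiable (h : IsAmplitudeFamily ω κ u) (ℓ : ℕ) (α : ℤ) :
    Differentiable ℝ (u ℓ α) := differentiable_of_smooth (h.smooth ℓ α)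

lemma amp_of_max_natAbs_eq (p : Slow) (s t : ℕ) {ℓ : ℕ} {α : ℤ} (hα : max 1 α.natAbs = ℓ) :
    amp ω κ u p ℓ s t α = wave (waveK κ) (waveΩ ω κ) α s t * u ℓ α p := by
  simp [amp, wave, hα, shiftOp]

lemma amp_two (h : IsAmplitudeFamily ω κ u) (p : Slow) (s t : ℕ) {α : ℤ} (hα : α.natAbs ≤ 1) :
    amp ω κ u p 2 s t α = wave (waveK κ) (waveΩ ω κ) α s t
      * (u 2 α p + (s - t * (deriv ω κ : ℝ)) * δn₁ (u 1 α) p) := by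
  rw [amp, max_eq_left hα, show Finset.Icc 1 2 = {1, 2} by decide, Finset.sum_pair (by decide),
    shiftOp_one_eq (h.isTravelling 1 α) (h.differentiable 1 α), wave]
  simp only [Nat.sub_self, shiftOp]
  ring

lemma amp_three (h : IsAmplitudeFamily ω κ u) (p : Slow) (s t : ℕ) {α : ℤ}
    (hα : α.natAbs ≤ 1) :
    amp ω κ u p 3 s t α = wave (waveK κ) (waveΩ ω κ) α s t
      * (u 3 α p + (s - t * (deriv ω κ : ℝ)) * δn₁ (u 2 α) p
        + (1 / 2 * (s - t * (deriv ω κ : ℝ)) ^ 2 * δn₁ (δn₁ (u 1 α)) p + t * δm₂ (u 1 α) p)) := by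
  rw [amp, max_eq_left hα, show Finset.Icc 1 3 = {1, 2, 3} by decide,
    Finset.sum_insert (by decide), Finset.sum_pair (by decide),
    shiftOp_one_eq (h.isTravelling 2 α) (h.differentiable 2 α),
    shiftOp_two_eq (h.isTravelling 1 α) (h.smooth 1 α), wave]
  simp only [Nat.sub_self, shiftOp]
  ring

lemma amp_one_zero (h0 : u 1 0 = 0) (p : Slow) (s t : ℕ) : amp ω κ u p 1 s t 0 = 0 := by
  simp [amp_of_max_natAbs_eq, h0]

lemma amp_two_zero (h : IsAmplitudeFamily ω κ u) (h0 : u 1 0 = 0) (p : Slow) (s t : ℕ) :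
    amp ω κ u p 2 s t 0 = wave (waveK κ) (waveΩ ω κ) 0 s t * u 2 0 p := by
  simp [amp_two h, h0, δn₁, D]

lemma W_one_apply (p : Slow) {α : ℤ} (hα : α.natAbs ≤ 1) :
    W P ω κ u 1 α p = linSymbol P (waveK κ ^ α) (waveΩ ω κ ^ α) * u 1 α p := by
  simp only [W_one, coeff_harmonics, if_pos hα, amp_of_max_natAbs_eq p _ _ (max_eq_left hα),
    ← linMoment_zero 0, linMoment, linPart, Complex.real_smul]
  ring

lemma W_one_of_one_lt (p : Slow) {α : ℤ} (hα : 1 < α.natAbs) : W P ω κ u 1 α p = 0 := by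
  simp [W_one, coeff_harmonics, hα.not_ge, linPart]

lemma W_two_of_two_lt (h0 : u 1 0 = 0) (p : Slow) {α : ℤ} (hα : 2 < α.natAbs) :
    W P ω κ u 2 α p = 0 := by
  have h₁ : ¬(α - 1).natAbs ≤ 1 := by omega
  have h₂ : ¬(α + 1).natAbs ≤ 1 := by omega
  simp [W_two, coeff_harmonics_one_mul (amp_one_zero h0 p _ _), coeff_harmonics, hα.not_ge, h₁, h₂,
    linPart, quadPart]

lemma W_two_two_mul (h0 : u 1 0 = 0) (p : Slow) {ε : ℤ} (hε : ε.natAbs = 1) :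
    W P ω κ u 2 (2 * ε) p =
      linSymbol P (waveK κ ^ (2 * ε)) (waveΩ ω κ ^ (2 * ε)) * u 2 (2 * ε) p
      + quadSymbol P (waveK κ) (waveΩ ω κ) ε ε / 2 * u 1 ε p ^ 2 := by
  have hm : (2 * ε).natAbs ≤ 2 := by omega
  have hq (c d : ℤ → ℂ) (hc : c 0 = 0) :
      (harmonics 1 c * harmonics 1 d).coeff (2 * ε) = c ε * d ε := by
    obtain rfl | rfl := Int.natAbs_eq_iff.mp hε <;>
      simp [coeff_harmonics_one_mul hc, coeff_harmonics]
  simp only [W_two, coeff_harmonics, if_pos hm, hq _ _ (amp_one_zero h0 p _ _),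
    amp_of_max_natAbs_eq p _ _ (show max 1 (2 * ε).natAbs = 2 by omega),
    amp_of_max_natAbs_eq p _ _ (show max 1 ε.natAbs = 1 by omega), ← linMoment_zero 0, linMoment,
    linPart, quadSymbol, quadPart, Complex.real_smul]
  ring

lemma W_two_zero (h : IsAmplitudeFamily ω κ u) (h0 : u 1 0 = 0) (p : Slow) :
    W P ω κ u 2 0 p = 2 * (P.a₁ + P.a₂) * u 2 0 p
      + quadSymbol P (waveK κ) (waveΩ ω κ) 1 (-1) * (u 1 1 p * u 1 (-1) p) := by
  have hq (c d : ℤ → ℂ) (hc : c 0 = 0) :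
      (harmonics 1 c * harmonics 1 d).coeff 0 = c 1 * d (-1) + c (-1) * d 1 := by
    simp [coeff_harmonics_one_mul hc, coeff_harmonics]
  have hl : 2 * ((P.a₁ : ℂ) + P.a₂) = linMoment P (waveK κ) (waveΩ ω κ) 0 0 0 := by
    simp only [linMoment_zero, linSymbol, zpow_zero, mul_one]
    ring
  simp only [W_two, coeff_harmonics, hq _ _ (amp_one_zero h0 p _ _), amp_two_zero h h0,
    amp_of_max_natAbs_eq p _ _ (show max 1 (1 : ℤ).natAbs = 1 by decide),
    amp_of_max_natAbs_eq p _ _ (show max 1 (-1 : ℤ).natAbs = 1 by decide), hl, linMoment,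
    linPart, quadSymbol, quadPart, Complex.real_smul, Int.natAbs_zero, zero_le, if_true]
  ring

lemma W_two_of_natAbs_eq_one (h : IsAmplitudeFamily ω κ u) (h0 : u 1 0 = 0) (p : Slow) {α : ℤ}
    (hα : α.natAbs = 1) :
    W P ω κ u 2 α p = linSymbol P (waveK κ ^ α) (waveΩ ω κ ^ α) * u 2 α p
      + linMoment P (waveK κ) (waveΩ ω κ) (deriv ω κ) 1 α * δn₁ (u 1 α) p := by
  have hm : α.natAbs ≤ 2 := by omega
  have hq (c d : ℤ → ℂ) (hc : c 0 = 0) (hd : d 0 = 0) :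
      (harmonics 1 c * harmonics 1 d).coeff α = 0 := by
    obtain rfl | rfl := Int.natAbs_eq_iff.mp hα <;>
      simp [coeff_harmonics_one_mul hc, coeff_harmonics, hd]
  simp only [W_two, coeff_harmonics, if_pos hm, amp_two h p _ _ hα.le,
    hq _ _ (amp_one_zero h0 p _ _) (amp_one_zero h0 p _ _), ← linMoment_zero 0, linMoment,
    linPart, quadPart, Complex.real_smul]
  ring

lemma W_three_one (h : IsAmplitudeFamily ω κ u) (h0 : u 1 0 = 0) (p : Slow) :
    W P ω κ u 3 1 p = linSymbol P (waveK κ) (waveΩ ω κ) * u 3 1 p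
      + linMoment P (waveK κ) (waveΩ ω κ) (deriv ω κ) 1 1 * δn₁ (u 2 1) p
      + linMoment P (waveK κ) (waveΩ ω κ) (deriv ω κ) 2 1 / 2 * δn₁ (δn₁ (u 1 1)) p
      + timeSymbol P (waveK κ) (waveΩ ω κ) * δm₂ (u 1 1) p
      + quadSymbol P (waveK κ) (waveΩ ω κ) 0 1 * (u 2 0 p * u 1 1 p)
      + quadSymbol P (waveK κ) (waveΩ ω κ) 2 (-1) * (u 2 2 p * u 1 (-1) p)
      + cubSymbol P (waveK κ) (waveΩ ω κ) * (u 1 1 p ^ 2 * u 1 (-1) p) := by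
  have hq (c d : ℤ → ℂ) (hc : c 0 = 0) :
      (harmonics 1 c * harmonics 2 d).coeff 1 = c 1 * d 0 + c (-1) * d 2 := by
    simp [coeff_harmonics_one_mul hc, coeff_harmonics]
  have hq' (c d : ℤ → ℂ) (hd : d 0 = 0) :
      (harmonics 2 c * harmonics 1 d).coeff 1 = d 1 * c 0 + d (-1) * c 2 := by
    rw [mul_comm, hq d c hd]
  have hc (b c d : ℤ → ℂ) (hb : b 0 = 0) (hc : c 0 = 0) :
      (harmonics 1 b * harmonics 1 c * harmonics 1 d).coeff 1 =
        b (-1) * c 1 * d 1 + b 1 * c (-1) * d 1 + b 1 * c 1 * d (-1) := by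
    simp only [mul_assoc, coeff_harmonics_one_mul hb, coeff_harmonics_one_mul hc, coeff_harmonics]
    norm_num
    ring
  have hl := linMoment_zero (P := P) (K := waveK κ) (Ω := waveΩ ω κ) 0 1
  rw [zpow_one, zpow_one] at hl
  have h₁ := amp_one_zero (ω := ω) (κ := κ) h0 p
  simp only [W_three, coeff_harmonics, hq _ _ (h₁ _ _), hq' _ _ (h₁ _ _),
    hc _ _ _ (h₁ _ _) (h₁ _ _), amp_two_zero h h0,
    amp_three h p _ _ (show (1 : ℤ).natAbs ≤ 1 by decide),
    amp_of_max_natAbs_eq p _ _ (show max 1 (1 : ℤ).natAbs = 1 by decide),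
    amp_of_max_natAbs_eq p _ _ (show max 1 (-1 : ℤ).natAbs = 1 by decide),
    amp_of_max_natAbs_eq p _ _ (show max 1 (2 : ℤ).natAbs = 2 by decide),
    show (1 : ℤ).natAbs ≤ 3 by decide, if_true, ← hl, linMoment,
    linPart, timeSymbol, quadSymbol, quadPart, cubSymbol, cubPart, Complex.real_smul]
  ring

end OrderEquations

/-! ### Reduction to the nonlinear Schrödinger equation -/

section Reduction

variable {P : Coeffs} {ω : ℝ → ℝ} {κ : ℝ}

lemma waveK_ne_zero (κ : ℝ) : waveK κ ≠ 0 := Complex.exp_ne_zero _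

lemma waveΩ_ne_zero (ω : ℝ → ℝ) (κ : ℝ) : waveΩ ω κ ≠ 0 := Complex.exp_ne_zero _

lemma norm_waveK (κ : ℝ) : ‖waveK κ‖ = 1 := by
  rw [waveK, mul_comm, Complex.norm_exp_ofReal_mul_I]

lemma norm_waveΩ (ω : ℝ → ℝ) (κ : ℝ) : ‖waveΩ ω κ‖ = 1 := by
  rw [waveΩ, Complex.exp_neg, norm_inv, mul_comm, Complex.norm_exp_ofReal_mul_I, inv_one]

lemma conj_waveK (κ : ℝ) : conj (waveK κ) = (waveK κ)⁻¹ :=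
  (Complex.inv_eq_conj (norm_waveK κ)).symm

lemma conj_waveΩ (ω : ℝ → ℝ) (κ : ℝ) : conj (waveΩ ω κ) = (waveΩ ω κ)⁻¹ :=
  (Complex.inv_eq_conj (norm_waveΩ ω κ)).symm

lemma hasDerivAt_waveK (κ : ℝ) : HasDerivAt waveK (waveK κ * Complex.I) κ := by
  have h := ((hasDerivAt_id κ).ofReal_comp.const_mul Complex.I).cexp
  rw [Complex.ofReal_one, mul_one] at h
  exact h

lemma hasDerivAt_waveΩ (hω : DifferentiableAt ℝ ω κ) :
    HasDerivAt (waveΩ ω) (waveΩ ω κ * -(Complex.I * (deriv ω κ : ℝ))) κ :=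
  (hω.hasDerivAt.ofReal_comp.const_mul Complex.I).neg.cexp

/-- The dispersion relation, differentiated, says that `ω'(κ)` is the group velocity. -/
lemma IsDispersionRelation.linMoment_one_one (h : IsDispersionRelation P ω) (κ : ℝ) :
    linMoment P (waveK κ) (waveΩ ω κ) (deriv ω κ) 1 1 = 0 := by
  have hK := hasDerivAt_waveK κ
  have hΩ := hasDerivAt_waveΩ (h.1 κ)
  have hderiv : HasDerivAt (fun k => linSymbol P (waveK k) (waveΩ ω k))
      (Complex.I * linMoment P (waveK κ) (waveΩ ω κ) (deriv ω κ) 1 1) κ := by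
    refine ((((hK.mul hΩ).const_add 1).const_mul (P.a₁ : ℂ)).add
      ((hK.add hΩ).const_mul (P.a₂ : ℂ))).congr_deriv ?_
    simp only [linMoment, linPart, wave, Complex.real_smul, Nat.cast_zero, Nat.cast_one, zero_mul,
      one_mul, mul_zero, mul_one, zpow_zero, zpow_one, pow_one, sub_zero]
    ring
  have hzero : (fun k => linSymbol P (waveK k) (waveΩ ω k)) = fun _ => 0 := funext h.2
  rw [hzero] at hderiv
  exact (mul_eq_zero.mp (hderiv.unique (hasDerivAt_const κ 0))).resolve_left Complex.I_ne_zero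

lemma timeSymbol_eq (K Ω : ℂ) : timeSymbol P K Ω = (P.a₁ * K + P.a₂) * Ω := by
  simp only [timeSymbol, linPart, wave, Complex.real_smul, Nat.cast_zero, Nat.cast_one, one_mul,
    mul_zero, mul_one, zpow_zero, zpow_one]
  ring

lemma timeSymbol_ne_zero (ha : |P.a₁| ≠ |P.a₂|) {K Ω : ℂ} (hK : ‖K‖ = 1) (hΩ : Ω ≠ 0) :
    timeSymbol P K Ω ≠ 0 := by
  rw [timeSymbol_eq]
  refine mul_ne_zero (fun h => ha ?_) hΩ
  simpa [hK] using congrArg norm (eq_neg_of_add_eq_zero_left h)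

lemma add_ne_zero_of_abs_ne {a b : ℝ} (h : |a| ≠ |b|) : a + b ≠ 0 := fun e => h <| by
  rw [eq_neg_of_add_eq_zero_left e, abs_neg]

/-- The coefficient `ρ₁` of `∂_ξ² u` in the reduced equation, at group velocity `v`. -/
def dispersionCoeff (P : Coeffs) (K Ω : ℂ) (v : ℝ) : ℂ :=
  linMoment P K Ω v 2 1 / 2 / (-Complex.I * timeSymbol P K Ω)

/-- The coefficient of `u |u|²` in `𝒲₃^{(1)}`: the cubic self-interaction, corrected by the second
harmonic and the mean field that the first harmonic generates at order `ε²`. -/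
def cubicCoeff (P : Coeffs) (K Ω : ℂ) : ℂ :=
  cubSymbol P K Ω
    - quadSymbol P K Ω 2 (-1) * (quadSymbol P K Ω 1 1 / 2) / linSymbol P (K ^ 2) (Ω ^ 2)
    - quadSymbol P K Ω 0 1 * quadSymbol P K Ω 1 (-1) / (2 * (P.a₁ + P.a₂))

/-- The coefficient `ρ₂` of `u |u|²` in the reduced equation. -/
def nonlinearCoeff (P : Coeffs) (K Ω : ℂ) : ℂ :=
  cubicCoeff P K Ω / (-Complex.I * timeSymbol P K Ω)

lemma reducesToNLS (ha : |P.a₁| ≠ |P.a₂|) (hω : IsDispersionRelation P ω)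
    (hκ : IsNonresonant P ω κ) :
    ReducesToNLS P ω κ (dispersionCoeff P (waveK κ) (waveΩ ω κ) (deriv ω κ))
      (nonlinearCoeff P (waveK κ) (waveΩ ω κ)) := by
  have hτ : timeSymbol P (waveK κ) (waveΩ ω κ) ≠ 0 :=
    timeSymbol_ne_zero ha (norm_waveK κ) (waveΩ_ne_zero ω κ)
  have hs : (P.a₁ : ℂ) + P.a₂ ≠ 0 := mod_cast add_ne_zero_of_abs_ne ha
  refine ⟨-Complex.I * timeSymbol P (waveK κ) (waveΩ ω κ),
    mul_ne_zero (neg_ne_zero.mpr Complex.I_ne_zero) hτ, fun u hu h₁ h₂ p => ?_⟩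
  have h0 : u 1 0 = 0 := funext fun q => by
    have h := h₁ 0 q
    rw [W_one_apply q (by decide)] at h
    refine (mul_eq_zero.mp h).resolve_left fun h => hs ?_
    simp only [linSymbol, zpow_zero] at h
    linear_combination h / 2
  have mean : u 2 0 p = -(quadSymbol P (waveK κ) (waveΩ ω κ) 1 (-1) * (u 1 1 p * u 1 (-1) p))
      / (2 * (P.a₁ + P.a₂)) := by
    have h := h₂ 0 p
    rw [W_two_zero hu h0] at h
    rw [eq_div_iff (mul_ne_zero two_ne_zero hs)]
    linear_combination h
  have second_harmonic : u 2 2 p = -(quadSymbol P (waveK κ) (waveΩ ω κ) 1 1 / 2 * u 1 1 p ^ 2)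
      / linSymbol P (waveK κ ^ 2) (waveΩ ω κ ^ 2) := by
    have h := h₂ (2 * 1) p
    rw [W_two_two_mul h0 p rfl, mul_one, zpow_ofNat, zpow_ofNat] at h
    rw [eq_div_iff hκ.2]
    linear_combination h
  have norm_sq : (‖u 1 1 p‖ : ℂ) ^ 2 = u 1 1 p * u 1 (-1) p := by
    rw [hu.real 1 1 p, Complex.mul_conj']
  rw [W_three_one hu h0, hω.2 κ, hω.linMoment_one_one κ, mean, second_harmonic, norm_sq,
    dispersionCoeff, nonlinearCoeff, cubicCoeff]
  field_simp
  linear_combination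
    2 * timeSymbol P (waveK κ) (waveΩ ω κ) * δm₂ (u 1 1) p * (P.a₁ + P.a₂) * Complex.I_sq

end Reduction

/-! ### Uniqueness of the reduced equation -/

section Uniqueness

variable {P : Coeffs} {ω : ℝ → ℝ} {κ : ℝ} {f : Slow → ℂ}

/-- The amplitudes of orders `1` and `2` generated by the first harmonic `u₁^{(1)} = f`, with
second harmonic `C f²` and mean field `M |f|²`. -/
def slavedAmplitudes (C M : ℂ) (f : Slow → ℂ) (ℓ : ℕ) (α : ℤ) (p : Slow) : ℂ :=
  if ℓ = 1 ∧ α = 1 then f p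
  else if ℓ = 1 ∧ α = -1 then conj (f p)
  else if ℓ = 2 ∧ α = 2 then C * f p ^ 2
  else if ℓ = 2 ∧ α = -2 then conj (C * f p ^ 2)
  else if ℓ = 2 ∧ α = 0 then M * (f p * conj (f p))
  else 0

lemma isAmplitudeFamily_slavedAmplitudes {C M : ℂ} (hM : conj M = M)
    (hf : ContDiff ℝ (⊤ : ℕ∞) f) (hb : ∃ B, ∀ p, ‖f p‖ ≤ B) (ht : IsTravelling (deriv ω κ) f) :
    IsAmplitudeFamily ω κ (slavedAmplitudes C M f) where
  smooth ℓ α := by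
    have hconj : ContDiff ℝ (⊤ : ℕ∞) (⇑(starRingEnd ℂ)) := Complex.conjCLE.contDiff
    unfold slavedAmplitudes
    split_ifs
    exacts [hf, hconj.comp hf, contDiff_const.mul (hf.pow 2),
      hconj.comp (contDiff_const.mul (hf.pow 2)), contDiff_const.mul (hf.mul (hconj.comp hf)),
      contDiff_const]
  bounded ℓ α := by
    obtain ⟨B, hB⟩ := hb
    refine ⟨B + ‖C‖ * B ^ 2 + ‖M‖ * B ^ 2, fun p => ?_⟩
    have hBp := hB p
    have hfp := norm_nonneg (f p)
    have hC : 0 ≤ ‖C‖ * B ^ 2 := by positivity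
    have hM : 0 ≤ ‖M‖ * B ^ 2 := by positivity
    have hsq : ‖f p‖ ^ 2 ≤ B ^ 2 := by gcongr
    have hCsq := mul_le_mul_of_nonneg_left hsq (norm_nonneg C)
    have hMsq := mul_le_mul_of_nonneg_left hsq (norm_nonneg M)
    unfold slavedAmplitudes
    split_ifs <;> simp [← sq] <;> linarith
  real ℓ α p := by
    unfold slavedAmplitudes
    split_ifs <;> first | omega | simp [hM, mul_comm]
  travelling ℓ α n₁ m₁ m₂ := by
    have h : f (n₁, m₁, m₂) = f (n₁ - deriv ω κ * m₁, 0, m₂) := by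
      rw [ht (n₁, m₁, m₂), toFrame_apply]
    simp only [slavedAmplitudes, h]

lemma IsDispersionRelation.linSymbol_zpow_eq_zero (h : IsDispersionRelation P ω) {α : ℤ}
    (hα : α.natAbs = 1) : linSymbol P (waveK κ ^ α) (waveΩ ω κ ^ α) = 0 := by
  obtain rfl | rfl := Int.natAbs_eq_iff.mp hα
  · simpa using h.2 κ
  · have hconj := conj_linMoment (P := P) (conj_waveK κ) (conj_waveΩ ω κ) 0 0 1
    simpa [linMoment_zero, h.2 κ] using hconj.symm

lemma IsDispersionRelation.linMoment_one_eq_zero (h : IsDispersionRelation P ω) {α : ℤ}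
    (hα : α.natAbs = 1) : linMoment P (waveK κ) (waveΩ ω κ) (deriv ω κ) 1 α = 0 := by
  obtain rfl | rfl := Int.natAbs_eq_iff.mp hα
  · exact h.linMoment_one_one κ
  · have hconj := conj_linMoment (P := P) (conj_waveK κ) (conj_waveΩ ω κ) (deriv ω κ) 1 1
    simpa [h.linMoment_one_one κ] using hconj.symm

lemma IsDispersionRelation.W_one_eq_zero (h : IsDispersionRelation P ω)
    {u : ℕ → ℤ → Slow → ℂ} (h0 : u 1 0 = 0) (α : ℤ) (p : Slow) : W P ω κ u 1 α p = 0 := by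
  by_cases hα : 1 < α.natAbs
  · exact W_one_of_one_lt p hα
  rw [W_one_apply p (not_lt.mp hα)]
  obtain rfl | hα : α = 0 ∨ α.natAbs = 1 := by omega
  · simp [h0]
  · simp [h.linSymbol_zpow_eq_zero hα]

lemma exists_isAmplitudeFamily (ha : |P.a₁| ≠ |P.a₂|) (hω : IsDispersionRelation P ω)
    (hκ : IsNonresonant P ω κ) (hf : ContDiff ℝ (⊤ : ℕ∞) f) (hb : ∃ B, ∀ p, ‖f p‖ ≤ B)
    (ht : IsTravelling (deriv ω κ) f) :
    ∃ u, IsAmplitudeFamily ω κ u ∧ (∀ α p, W P ω κ u 1 α p = 0) ∧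
      (∀ α p, W P ω κ u 2 α p = 0) ∧ u 1 1 = f := by
  have hs : (P.a₁ : ℂ) + P.a₂ ≠ 0 := mod_cast add_ne_zero_of_abs_ne ha
  have hK := conj_waveK κ
  have hΩ := conj_waveΩ ω κ
  set C := -(quadSymbol P (waveK κ) (waveΩ ω κ) 1 1 / 2) / linSymbol P (waveK κ ^ 2) (waveΩ ω κ ^ 2)
    with hC
  set M := -quadSymbol P (waveK κ) (waveΩ ω κ) 1 (-1) / (2 * (P.a₁ + P.a₂)) with hM
  have hu : IsAmplitudeFamily ω κ (slavedAmplitudes C M f) := by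
    refine isAmplitudeFamily_slavedAmplitudes ?_ hf hb ht
    rw [hM, map_div₀, map_neg, conj_quadSymbol hK hΩ, neg_neg, quadSymbol_comm (-1) 1, map_mul,
      map_ofNat, map_add, Complex.conj_ofReal, Complex.conj_ofReal]
  have h0 : slavedAmplitudes C M f 1 0 = 0 := by ext; simp [slavedAmplitudes]
  have second_harmonic (p : Slow) :
      linMoment P (waveK κ) (waveΩ ω κ) 0 0 2 * (C * f p ^ 2)
        + quadSymbol P (waveK κ) (waveΩ ω κ) 1 1 / 2 * f p ^ 2 = 0 := by
    rw [linMoment_zero, zpow_ofNat, zpow_ofNat, hC]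
    field_simp [hκ.2]
    ring
  refine ⟨_, hu, hω.W_one_eq_zero h0, fun α p => ?_, by ext; simp [slavedAmplitudes]⟩
  obtain rfl | hα | rfl | rfl | hα :
    α = 0 ∨ α.natAbs = 1 ∨ α = 2 * 1 ∨ α = 2 * -1 ∨ 2 < α.natAbs := by omega
  · rw [W_two_zero hu h0]
    have hmean : 2 * ((P.a₁ : ℂ) + P.a₂) * M = -quadSymbol P (waveK κ) (waveΩ ω κ) 1 (-1) :=
      mul_div_cancel₀ _ (mul_ne_zero two_ne_zero hs)
    suffices 2 * ((P.a₁ : ℂ) + P.a₂) * (M * (f p * conj (f p)))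
        + quadSymbol P (waveK κ) (waveΩ ω κ) 1 (-1) * (f p * conj (f p)) = 0 by
      simpa [slavedAmplitudes] using this
    linear_combination f p * conj (f p) * hmean
  · rw [W_two_of_natAbs_eq_one hu h0 p hα, hω.linSymbol_zpow_eq_zero hα,
      hω.linMoment_one_eq_zero hα, zero_mul, zero_mul, add_zero]
  · rw [W_two_two_mul h0 p rfl, ← linMoment_zero 0]
    simpa [slavedAmplitudes] using second_harmonic p
  · rw [W_two_two_mul h0 p rfl, ← linMoment_zero 0]
    have h := congrArg conj (second_harmonic p)
    simp only [map_add, map_mul, map_div₀, map_pow, map_ofNat, map_zero, conj_linMoment hK hΩ,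
      conj_quadSymbol hK hΩ] at h
    simpa [slavedAmplitudes] using h
  · exact W_two_of_two_lt h0 p hα

/-- The wave `e^{i(q ξ + r m₂)}` in the frame `ξ = n₁ - v m₁`. -/
def planeWave (v q r : ℝ) (p : Slow) : ℂ :=
  Complex.exp (((q * (p.1 - v * p.2.1) + r * p.2.2 : ℝ) : ℂ) * Complex.I)

lemma norm_planeWave (v q r : ℝ) (p : Slow) : ‖planeWave v q r p‖ = 1 :=
  Complex.norm_exp_ofReal_mul_I _

lemma contDiff_planeWave (v q r : ℝ) : ContDiff ℝ (⊤ : ℕ∞) (planeWave v q r) :=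
  ((Complex.ofRealCLM.contDiff.comp
    (show ContDiff ℝ _ fun p : Slow => q * (p.1 - v * p.2.1) + r * p.2.2 by fun_prop)).mul
    contDiff_const).cexp

lemma isTravelling_planeWave (v q r : ℝ) : IsTravelling v (planeWave v q r) := fun p => by
  simp [planeWave, toFrame_apply]

lemma D_planeWave (v q r : ℝ) (w p : Slow) :
    D w (planeWave v q r) p =
      ((q * (w.1 - v * w.2.1) + r * w.2.2 : ℝ) : ℂ) * Complex.I * planeWave v q r p := by
  let φ : Slow →L[ℝ] ℝ := (q • (ContinuousLinearMap.fst ℝ ℝ (ℝ × ℝ)) +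
    r • (ContinuousLinearMap.snd ℝ ℝ ℝ).comp (ContinuousLinearMap.snd ℝ ℝ (ℝ × ℝ))).comp (toFrame v)
  have hφ (w : Slow) : φ w = q * (w.1 - v * w.2.1) + r * w.2.2 := by simp [φ, toFrame_apply]
  have hd := ((Complex.ofRealCLM.comp φ).hasFDerivAt (x := p)).mul_const Complex.I |>.cexp
  have e : planeWave v q r = fun y => Complex.exp ((Complex.ofRealCLM.comp φ) y * Complex.I) := by
    ext y
    simp [planeWave, hφ]
  rw [D, e, hd.fderiv]
  simp only [ContinuousLinearMap.comp_apply, hφ, Complex.ofRealCLM_apply, smul_apply, smul_eq_mul]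
  ring

lemma ReducesToNLS.unique (ha : |P.a₁| ≠ |P.a₂|) (hω : IsDispersionRelation P ω)
    (hκ : IsNonresonant P ω κ) {ρ₁ ρ₂ σ₁ σ₂ : ℂ} (hρ : ReducesToNLS P ω κ ρ₁ ρ₂)
    (hσ : ReducesToNLS P ω κ σ₁ σ₂) : ρ₁ = σ₁ ∧ ρ₂ = σ₂ := by
  obtain ⟨c, hc, hρ⟩ := hρ
  obtain ⟨d, -, hσ⟩ := hσ
  have dispersion (q r : ℝ) : c * (-r - ρ₁ * q ^ 2 + ρ₂) = d * (-r - σ₁ * q ^ 2 + σ₂) := by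
    set f := planeWave (deriv ω κ) q r with hf_def
    have hf : ContDiff ℝ (⊤ : ℕ∞) f := contDiff_planeWave (deriv ω κ) q r
    obtain ⟨u, hu, h₁, h₂, huf : u 1 1 = f⟩ := exists_isAmplitudeFamily ha hω hκ hf
      ⟨1, fun p => (norm_planeWave _ q r p).le⟩ (isTravelling_planeWave _ q r)
    have hf0 : f 0 = 1 := by simp [hf_def, planeWave]
    have hm₂ : δm₂ f 0 = r * Complex.I := by simp [δm₂, hf_def, D_planeWave, planeWave]
    have hn₁ : δn₁ f = fun p => q * Complex.I * f p := by
      ext p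
      simp [δn₁, hf_def, D_planeWave]
    have hn₁n₁ : δn₁ (δn₁ f) 0 = (q * Complex.I) ^ 2 := by
      rw [hn₁, δn₁, D_const_mul (differentiable_of_smooth hf), ← δn₁, hn₁]
      simp only [hf0]
      ring
    have h := (hρ u hu h₁ h₂ 0).symm.trans (hσ u hu h₁ h₂ 0)
    rw [huf, hm₂, hn₁n₁, hf0] at h
    simp only [norm_one, Complex.ofReal_one, one_pow, mul_one] at h
    linear_combination h - (c * (r + ρ₁ * q ^ 2) - d * (r + σ₁ * q ^ 2)) * Complex.I_sq
  have h₀₀ := dispersion 0 0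
  have h₀₁ := dispersion 0 1
  have h₁₀ := dispersion 1 0
  push_cast at h₀₀ h₀₁ h₁₀
  obtain rfl : c = d := by linear_combination h₀₀ - h₀₁
  exact ⟨mul_left_cancel₀ hc (by linear_combination h₀₀ - h₁₀),
    mul_left_cancel₀ hc (by linear_combination h₀₀)⟩

lemma existsUnique_reducesToNLS (ha : |P.a₁| ≠ |P.a₂|) (hω : IsDispersionRelation P ω)
    (hκ : IsNonresonant P ω κ) : ∃! ρ : ℂ × ℂ, ReducesToNLS P ω κ ρ.1 ρ.2 :=
  ⟨(_, _), reducesToNLS ha hω hκ, fun _ hσ =>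
    Prod.ext_iff.mpr (hσ.unique ha hω hκ (reducesToNLS ha hω hκ))⟩

end Uniqueness

/-! ### The imaginary part of the nonlinear coefficient -/

section HalfWaves

/-- The quadratic symbol at `K = k²`, `Ω = v²`, divided by the phase of the midpoint of the
elementary square. -/
def centredQuad (P : Coeffs) (k v : ℂ) (α β : ℤ) : ℂ :=
  quadSymbol P (k ^ 2) (v ^ 2) α β / (k * v) ^ (α + β)

/-- The cubic symbol at `K = k²`, `Ω = v²`, divided by the phase of the midpoint of the
elementary square. -/
def centredCub (P : Coeffs) (k v : ℂ) : ℂ := cubSymbol P (k ^ 2) (v ^ 2) / (k * v)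

variable {P : Coeffs} {k v : ℂ}

variable (hk : ‖k‖ = 1) (hv : ‖v‖ = 1)
include hk hv

lemma linSymbol_sq : linSymbol P (k ^ 2) (v ^ 2)
    = 2 * (k * v) * (P.a₁ * (k * v).re + P.a₂ * (k * conj v).re : ℝ) := by
  have hk₀ : k ≠ 0 := norm_ne_zero_iff.mp (hk ▸ one_ne_zero)
  have hv₀ : v ≠ 0 := norm_ne_zero_iff.mp (hv ▸ one_ne_zero)
  push_cast
  simp only [linSymbol, Complex.re_eq_add_conj, map_mul, ← Complex.inv_eq_conj hk,
    ← Complex.inv_eq_conj hv, map_inv₀, inv_inv]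
  field_simp
  ring

lemma timeSymbol_sq (h : linSymbol P (k ^ 2) (v ^ 2) = 0) :
    -Complex.I * timeSymbol P (k ^ 2) (v ^ 2)
      = k * v * (P.a₁ * (k * v).im - P.a₂ * (k * conj v).im : ℝ) := by
  have hk₀ : k ≠ 0 := norm_ne_zero_iff.mp (hk ▸ one_ne_zero)
  have hv₀ : v ≠ 0 := norm_ne_zero_iff.mp (hv ▸ one_ne_zero)
  rw [linSymbol] at h
  rw [timeSymbol_eq]
  push_cast
  simp only [Complex.im_eq_sub_conj, map_mul, ← Complex.inv_eq_conj hk,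
    ← Complex.inv_eq_conj hv, map_inv₀, inv_inv]
  field_simp
  linear_combination h + (P.a₁ * k ^ 2 + P.a₂) * v ^ 2 * (-2) * Complex.I_sq

lemma centredQuad_eq (α β : ℤ) : centredQuad P k v α β =
    ⟨4 * P.α₁ * (k ^ (α - β)).re * (v ^ (α + β)).re
        + 4 * P.β₁ * (v ^ (α - β)).re * (k ^ (α + β)).re
        + 2 * P.γ₁ * ((k * v) ^ (α - β)).re + 2 * P.γ₂ * ((k * conj v) ^ (α - β)).re,
      4 * P.α₂ * (k ^ (α - β)).re * (v ^ (α + β)).im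
        + 4 * P.β₂ * (v ^ (α - β)).re * (k ^ (α + β)).im⟩ := by
  have hk₀ : k ≠ 0 := norm_ne_zero_iff.mp (hk ▸ one_ne_zero)
  have hv₀ : v ≠ 0 := norm_ne_zero_iff.mp (hv ▸ one_ne_zero)
  have hkα : k ^ α ≠ 0 := zpow_ne_zero α hk₀
  have hkβ : k ^ β ≠ 0 := zpow_ne_zero β hk₀
  have hvα : v ^ α ≠ 0 := zpow_ne_zero α hv₀
  have hvβ : v ^ β ≠ 0 := zpow_ne_zero β hv₀
  rw [Complex.mk_eq_add_mul_I]
  push_cast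
  simp only [Complex.re_eq_add_conj, Complex.im_eq_sub_conj, map_zpow₀, map_mul,
    ← Complex.inv_eq_conj hk, ← Complex.inv_eq_conj hv, map_inv₀]
  simp only [centredQuad, quadSymbol, quadPart, wave, Complex.real_smul, sq, mul_zpow, inv_zpow,
    zpow_add₀ hk₀, zpow_add₀ hv₀, zpow_sub₀ hk₀, zpow_sub₀ hv₀, Nat.cast_zero, Nat.cast_one,
    zero_mul, one_mul, zpow_zero]
  generalize k ^ α = x at *
  generalize k ^ β = y at *
  generalize v ^ α = z at *
  generalize v ^ β = w at *
  push_cast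
  field_simp
  ring

lemma im_centredCub : (centredCub P k v).im
    = (P.ξ₁ - P.ξ₂ - (P.ξ₃ - P.ξ₄)) * (k * v + (conj k) ^ 3 * v + k * (conj v) ^ 3).im
      + (P.ξ₁ - P.ξ₂ + (P.ξ₃ - P.ξ₄)) * (k ^ 3 * v + conj k * v + conj k * (conj v) ^ 3).im := by
  have hk₀ : k ≠ 0 := norm_ne_zero_iff.mp (hk ▸ one_ne_zero)
  have hv₀ : v ≠ 0 := norm_ne_zero_iff.mp (hv ▸ one_ne_zero)
  rw [← Complex.ofReal_inj]
  push_cast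
  simp only [centredCub, cubSymbol, cubPart, wave, Complex.real_smul, Complex.im_eq_sub_conj,
    map_pow, map_zpow₀, map_mul, map_add, map_div₀, map_inv₀, Complex.conj_ofReal,
    ← Complex.inv_eq_conj hk, ← Complex.inv_eq_conj hv]
  norm_num
  field_simp
  ring

lemma cubicCoeff_sq {L : ℝ} (hL : linSymbol P ((k ^ 2) ^ 2) ((v ^ 2) ^ 2) = (k * v) ^ 2 * L) :
    cubicCoeff P (k ^ 2) (v ^ 2) = k * v * (centredCub P k v
      - centredQuad P k v 2 (-1) * centredQuad P k v 1 1 / (2 * L)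
      - centredQuad P k v 0 1 * centredQuad P k v 1 (-1) / (2 * (P.a₁ + P.a₂))) := by
  have hkv : k * v ≠ 0 := norm_ne_zero_iff.mp (by rw [norm_mul, hk, hv]; norm_num)
  have h (α β : ℤ) : quadSymbol P (k ^ 2) (v ^ 2) α β
      = (k * v) ^ (α + β) * centredQuad P k v α β :=
    (mul_div_cancel₀ _ (zpow_ne_zero _ hkv)).symm
  have hcub : cubSymbol P (k ^ 2) (v ^ 2) = k * v * centredCub P k v :=
    (mul_div_cancel₀ _ hkv).symm
  rw [cubicCoeff, h, h, h, h, hL, hcub]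
  norm_num
  field_simp

/-- Up to the real factor `(kv)⁻¹ (-i) timeSymbol`, the coefficient `ρ₂` is a combination of the
centred symbols with real coefficients, so its imaginary part is linear in theirs. -/
lemma im_eq_zero_of_nonlinearCoeff_eq_ofReal (hs : P.a₁ + P.a₂ ≠ 0)
    (hdisp : linSymbol P (k ^ 2) (v ^ 2) = 0) (hτ : timeSymbol P (k ^ 2) (v ^ 2) ≠ 0) {L : ℝ}
    (hL₀ : L ≠ 0) (hL : linSymbol P ((k ^ 2) ^ 2) ((v ^ 2) ^ 2) = (k * v) ^ 2 * L) {ρ : ℝ}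
    (hρ : nonlinearCoeff P (k ^ 2) (v ^ 2) = ρ) :
    2 * (P.a₁ + P.a₂) * L * (centredCub P k v).im
      - (P.a₁ + P.a₂) * (centredQuad P k v 2 (-1) * centredQuad P k v 1 1).im
      - L * ((centredQuad P k v 0 1).im * (centredQuad P k v 1 (-1)).re) = 0 := by
  have hkv : k * v ≠ 0 := norm_ne_zero_iff.mp (by rw [norm_mul, hk, hv]; norm_num)
  have hmean : (centredQuad P k v 1 (-1)).im = 0 := by simp [centredQuad_eq hk hv]
  rw [nonlinearCoeff, div_eq_iff (mul_ne_zero (neg_ne_zero.mpr Complex.I_ne_zero) hτ),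
    timeSymbol_sq hk hv hdisp, cubicCoeff_sq hk hv hL, mul_left_comm, ← Complex.ofReal_mul] at hρ
  have hρ' := mul_left_cancel₀ hkv hρ
  set T := P.a₁ * (k * v).im - P.a₂ * (k * conj v).im
  have hreal : ((2 * (P.a₁ + P.a₂) * L : ℝ) : ℂ) * centredCub P k v
      - ((P.a₁ + P.a₂ : ℝ) : ℂ) * (centredQuad P k v 2 (-1) * centredQuad P k v 1 1)
      - (L : ℂ) * (centredQuad P k v 0 1 * centredQuad P k v 1 (-1))
      = ((2 * (P.a₁ + P.a₂) * L * (ρ * T) : ℝ) : ℂ) := by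
    have hs' : (P.a₁ : ℂ) + P.a₂ ≠ 0 := mod_cast hs
    have hL' : (L : ℂ) ≠ 0 := mod_cast hL₀
    rw [Complex.ofReal_mul _ (ρ * T), ← hρ']
    push_cast
    field_simp
  have him := congrArg Complex.im hreal
  rw [Complex.sub_im, Complex.sub_im, Complex.im_ofReal_mul, Complex.im_ofReal_mul,
    Complex.im_ofReal_mul, Complex.ofReal_im, Complex.mul_im (centredQuad P k v 0 1), hmean] at him
  linear_combination him

end HalfWaves

section Curve

/-- `z` is the unit complex number `c (x + i y)`. -/
structure IsUnitAlong (z : ℂ) (c x y : ℝ) : Prop where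
  re : z.re = c * x
  im : z.im = c * y
  sq_mul : c ^ 2 * (x ^ 2 + y ^ 2) = 1

namespace IsUnitAlong

variable {z : ℂ} {c x y : ℝ} (h : IsUnitAlong z c x y)
include h

lemma norm : ‖z‖ = 1 := by
  rw [Complex.norm_def, Complex.normSq_apply, h.re, h.im, Real.sqrt_eq_one]
  linear_combination h.sq_mul

lemma ne_zero : x ^ 2 + y ^ 2 ≠ 0 := fun h₀ => by simpa [h₀] using h.sq_mul

lemma scale_ne_zero : c ≠ 0 := fun h₀ => by simpa [h₀] using h.sq_mul

lemma sq_eq : c ^ 2 = 1 / (x ^ 2 + y ^ 2) := eq_one_div_of_mul_eq_one_left h.sq_mul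

lemma re_sq : (z ^ 2).re = (x ^ 2 - y ^ 2) / (x ^ 2 + y ^ 2) := by
  rw [sq, Complex.mul_re, h.re, h.im]
  linear_combination (x ^ 2 - y ^ 2) * h.sq_eq

lemma im_sq : (z ^ 2).im = 2 * x * y / (x ^ 2 + y ^ 2) := by
  rw [sq, Complex.mul_im, h.re, h.im]
  linear_combination 2 * x * y * h.sq_eq

lemma re_cube : (z ^ 3).re = c * (x ^ 3 - 3 * x * y ^ 2) / (x ^ 2 + y ^ 2) := by
  rw [pow_succ, Complex.mul_re, h.re, h.im, h.re_sq, h.im_sq]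
  ring

lemma im_cube : (z ^ 3).im = c * (3 * x ^ 2 * y - y ^ 3) / (x ^ 2 + y ^ 2) := by
  rw [pow_succ, Complex.mul_im, h.re, h.im, h.re_sq, h.im_sq]
  ring

end IsUnitAlong

variable {P : Coeffs} {k v : ℂ} {c q r t : ℝ} (hk : IsUnitAlong k c 1 t) (hv : IsUnitAlong v q t r)
include hk hv

lemma centredQuad_one_one : centredQuad P k v 1 1 =
    ⟨4 * P.α₁ * (t ^ 2 - r ^ 2) / (t ^ 2 + r ^ 2) + 4 * P.β₁ * (1 - t ^ 2) / (1 + t ^ 2)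
        + 2 * (P.γ₁ + P.γ₂),
      8 * P.α₂ * (t * r) / (t ^ 2 + r ^ 2) + 8 * P.β₂ * t / (1 + t ^ 2)⟩ := by
  rw [centredQuad_eq hk.norm hv.norm]
  norm_num [hk.re_sq, hk.im_sq, hv.re_sq, hv.im_sq]
  constructor <;> ring

lemma centredQuad_one_neg_one_re : (centredQuad P k v 1 (-1)).re =
    (4 * P.α₁ * (1 - t ^ 2) * (t ^ 2 + r ^ 2) + 4 * P.β₁ * (t ^ 2 - r ^ 2) * (1 + t ^ 2)
      + 2 * P.γ₁ * ((1 - t ^ 2) * (t ^ 2 - r ^ 2) - 4 * t ^ 2 * r)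
      + 2 * P.γ₂ * ((1 - t ^ 2) * (t ^ 2 - r ^ 2) + 4 * t ^ 2 * r))
        / ((1 + t ^ 2) * (t ^ 2 + r ^ 2)) := by
  have h₁ := hk.ne_zero
  have h₂ := hv.ne_zero
  rw [one_pow] at h₁
  rw [centredQuad_eq hk.norm hv.norm]
  norm_num [mul_pow, ← map_pow, hk.re_sq, hk.im_sq, hv.re_sq, hv.im_sq]
  field_simp
  ring

lemma centredQuad_zero_one_im : (centredQuad P k v 0 1).im =
    c * q * (4 * P.α₂ * r + 4 * P.β₂ * t ^ 2) := by
  rw [centredQuad_eq hk.norm hv.norm]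
  norm_num [Complex.inv_re, Complex.normSq_eq_norm_sq, hk.norm, hv.norm, hk.re, hv.re, hk.im, hv.im]
  ring

lemma centredQuad_two_neg_one : centredQuad P k v 2 (-1) =
    ⟨c * q / ((1 + t ^ 2) * (t ^ 2 + r ^ 2)) *
        (4 * P.α₁ * (1 - 3 * t ^ 2) * t * (t ^ 2 + r ^ 2)
          + 4 * P.β₁ * (t ^ 3 - 3 * t * r ^ 2) * (1 + t ^ 2)
          + 2 * P.γ₁ * ((1 - 3 * t ^ 2) * (t ^ 3 - 3 * t * r ^ 2)
            - (3 * t - t ^ 3) * (3 * t ^ 2 * r - r ^ 3))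
          + 2 * P.γ₂ * ((1 - 3 * t ^ 2) * (t ^ 3 - 3 * t * r ^ 2)
            + (3 * t - t ^ 3) * (3 * t ^ 2 * r - r ^ 3))),
      c * q / ((1 + t ^ 2) * (t ^ 2 + r ^ 2)) *
        (4 * P.α₂ * (1 - 3 * t ^ 2) * r * (t ^ 2 + r ^ 2)
          + 4 * P.β₂ * (t ^ 3 - 3 * t * r ^ 2) * t * (1 + t ^ 2))⟩ := by
  have h₁ := hk.ne_zero
  have h₂ := hv.ne_zero
  rw [one_pow] at h₁
  rw [centredQuad_eq hk.norm hv.norm]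
  norm_num [mul_pow, ← map_pow, hk.re, hk.im, hv.re, hv.im, hk.re_cube, hk.im_cube, hv.re_cube,
    hv.im_cube]
  constructor <;> field_simp

lemma centredCub_im : (centredCub P k v).im = c * q / ((1 + t ^ 2) * (t ^ 2 + r ^ 2)) *
    ((P.ξ₁ - P.ξ₂ - (P.ξ₃ - P.ξ₄)) *
      ((t ^ 2 + r) * ((1 + t ^ 2) * (t ^ 2 + r ^ 2))
        + ((1 - 3 * t ^ 2) * r - (3 * t - t ^ 3) * t) * (t ^ 2 + r ^ 2)
        + (t * (t ^ 3 - 3 * t * r ^ 2) - (3 * t ^ 2 * r - r ^ 3)) * (1 + t ^ 2))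
    + (P.ξ₁ - P.ξ₂ + (P.ξ₃ - P.ξ₄)) *
      (((1 - 3 * t ^ 2) * r + (3 * t - t ^ 3) * t) * (t ^ 2 + r ^ 2)
        + (r - t ^ 2) * ((1 + t ^ 2) * (t ^ 2 + r ^ 2))
        - (t * (t ^ 3 - 3 * t * r ^ 2) + (3 * t ^ 2 * r - r ^ 3)) * (1 + t ^ 2))) := by
  have h₁ := hk.ne_zero
  have h₂ := hv.ne_zero
  rw [one_pow] at h₁
  rw [im_centredCub hk.norm hv.norm]
  simp only [Complex.add_im, Complex.mul_im, ← map_pow, Complex.conj_re, Complex.conj_im, hk.re,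
    hk.im, hv.re, hv.im, hk.re_cube, hk.im_cube, hv.re_cube, hv.im_cube]
  field_simp
  ring

/-- The linear symbol of the second harmonic at `K = k²`, `Ω = v²`, divided by its phase `(kv)²`,
for `a₁ = l (r + 1)`, `a₂ = l (r - 1)`, `k ∥ 1 + i t` and `v ∥ t + i r`. -/
def secondHarmonic (l r t : ℝ) : ℝ :=
  4 * l * r * ((1 - t ^ 2) * (t ^ 2 - r ^ 2) - 4 * t ^ 2) / ((1 + t ^ 2) * (t ^ 2 + r ^ 2))

/-- `γ₁ + γ₂ - r (γ₁ - γ₂)`, which vanishes exactly when `a₂ γ₁ = a₁ γ₂` for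
`a₁ = l (r + 1)`, `a₂ = l (r - 1)`, `l ≠ 0`. -/
def gammaDefect (P : Coeffs) (r : ℝ) : ℝ := P.γ₁ + P.γ₂ - r * (P.γ₁ - P.γ₂)

/-- The defect of the relation between `α₁ + β₁` and `γ₁ - γ₂` in the family `S4`. -/
def alphaBetaDefect (P : Coeffs) (r : ℝ) : ℝ := P.α₁ + P.β₁ - r * (P.γ₁ - P.γ₂)

/-- The first of two forms, bilinear in `(α₂, β₂) = (a, b)` and in `gammaDefect`,
`alphaBetaDefect` and `α₁ - β₁` (called `U`, `V` and `d`), out of which the quadratic part of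
`obstruction` is built. Exchanging `K` and `Ω` amounts to `a ↔ b`, `d ↦ -d`. -/
def outerForm (r U V d a b : ℝ) : ℝ :=
  V * ((r ^ 2 - 3) * a - 2 * r * b) + d * ((r ^ 2 + 5) * a + 10 * r * b)
    - U * ((r ^ 2 + 4) * a + r * b)

/-- The companion of `outerForm` that does not involve `V`. -/
def innerForm (r U d a b : ℝ) : ℝ :=
  2 * (r ^ 2 - 1) * (a - r * b) * d + U * ((3 * r ^ 2 + 1) * a + (r ^ 3 + 3 * r) * b)

/-- The coefficients, as a polynomial in `tan² (κ / 2)`, of the imaginary part of `ρ₂` for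
`a₁ = l (r + 1)` and `a₂ = l (r - 1)`, up to a common nonzero factor. -/
def obstruction (P : Coeffs) (l r : ℝ) : Fin 6 → ℝ :=
  let d := P.α₁ - P.β₁
  let U := gammaDefect P r
  let V := alphaBetaDefect P r
  let X := r * (l * (P.ξ₁ - P.ξ₂)) - P.α₂ * (d - (P.γ₁ + P.γ₂) / 2)
  let Y := r * (l * (P.ξ₃ - P.ξ₄)) - P.β₂ * (d + (P.γ₁ + P.γ₂) / 2)
  let E₁ := outerForm r U V d P.α₂ P.β₂
  let E₂ := outerForm r U V (-d) P.β₂ P.α₂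
  let E₃ := innerForm r U d P.α₂ P.β₂
  let E₄ := innerForm r U (-d) P.β₂ P.α₂
  ![3 * r ^ 5 * X,
    r ^ 3 * E₁ + (-4 * r ^ 5 + 8 * r ^ 3) * X + 5 * r ^ 4 * Y,
    4 * r * E₃ + (r ^ 3 + r) * E₁ + r ^ 2 * E₂ + (r ^ 5 - 4 * r ^ 3 - 3 * r) * X
      + (-4 * r ^ 4 + 16 * r ^ 2) * Y,
    4 * E₄ + (r ^ 2 + 1) * E₂ + r * E₁ + (4 * r ^ 3 - 16 * r) * X + (-r ^ 4 + 4 * r ^ 2 + 3) * Y,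
    E₂ - 5 * r * X + (4 * r ^ 2 - 8) * Y,
    -3 * Y]

lemma linSymbol_sq_sq {l : ℝ} (ha₁ : P.a₁ = l * (r + 1)) (ha₂ : P.a₂ = l * (r - 1)) :
    linSymbol P ((k ^ 2) ^ 2) ((v ^ 2) ^ 2) = (k * v) ^ 2 * secondHarmonic l r t := by
  have h₁ := hk.ne_zero
  have h₂ := hv.ne_zero
  rw [one_pow] at h₁
  have hre : secondHarmonic l r t
      = 2 * (P.a₁ * (k ^ 2 * v ^ 2).re + P.a₂ * (k ^ 2 * conj (v ^ 2)).re) := by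
    rw [secondHarmonic, ha₁, ha₂]
    simp only [Complex.mul_re, Complex.conj_re, Complex.conj_im, hk.re_sq, hk.im_sq, hv.re_sq,
      hv.im_sq]
    field_simp
    ring
  rw [linSymbol_sq (by simp [hk.norm]) (by simp [hv.norm]), hre]
  push_cast
  ring

lemma im_combination_eq_sum_obstruction {l : ℝ} (ha₁ : P.a₁ = l * (r + 1))
    (ha₂ : P.a₂ = l * (r - 1)) :
    2 * (P.a₁ + P.a₂) * secondHarmonic l r t * (centredCub P k v).im
      - (P.a₁ + P.a₂) * (centredQuad P k v 2 (-1) * centredQuad P k v 1 1).im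
      - secondHarmonic l r t * ((centredQuad P k v 0 1).im * (centredQuad P k v 1 (-1)).re) =
    -32 * l * r * c * q / ((1 + t ^ 2) ^ 2 * (t ^ 2 + r ^ 2) ^ 2)
      * ∑ i, obstruction P l r i * (t ^ 2) ^ (i : ℕ) := by
  have h₁ := hk.ne_zero
  have h₂ := hv.ne_zero
  rw [one_pow] at h₁
  rw [centredQuad_one_one hk hv, centredQuad_one_neg_one_re hk hv, centredQuad_zero_one_im hk hv,
    centredQuad_two_neg_one hk hv, centredCub_im hk hv, ha₁, ha₂, secondHarmonic,
    Complex.mul_im]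
  simp only [Fin.sum_univ_six, obstruction, gammaDefect, alphaBetaDefect, outerForm, innerForm,
    Matrix.cons_val, Fin.coe_ofNat_eq_mod, Nat.reduceMod]
  field_simp
  ring

end Curve

/-! ### The six families -/

section Forms

variable {r U V d a b : ℝ}

lemma eq_of_outerForm_of_innerForm (hr : r ^ 2 - 1 ≠ 0) (ha : a ≠ 0)
    (hout : outerForm r U V d a (-r * a) = 0) (hin : innerForm r U d a (-r * a) = 0) :
    U = 2 * d ∧ (r ^ 2 - 1) * V = (3 * r ^ 2 + 1) * d := by
  rw [outerForm] at hout
  rw [innerForm] at hin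
  have hp : r ^ 2 + 1 ≠ 0 := by positivity
  have hU : U = 2 * d :=
    mul_left_cancel₀ (mul_ne_zero (mul_ne_zero hr hp) ha) (by linear_combination -hin)
  rw [hU] at hout
  exact ⟨hU, mul_left_cancel₀ (mul_ne_zero three_ne_zero ha) (by linear_combination hout)⟩

/-- Two linear equations for `(U, d)`, with determinant `4 (r² - 1)² (a + r b) (b + r a)`. -/
lemma eq_zero_of_innerForm (hr : r ^ 2 - 1 ≠ 0) (hab : a + r * b ≠ 0) (hba : b + r * a ≠ 0)
    (h : innerForm r U d a b = 0) (h_swap : innerForm r U (-d) b a = 0) : U = 0 ∧ d = 0 := by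
  rw [innerForm] at h h_swap
  have hdet : 4 * (r ^ 2 - 1) ^ 2 * ((a + r * b) * (b + r * a)) ≠ 0 :=
    mul_ne_zero (mul_ne_zero four_ne_zero (pow_ne_zero 2 hr)) (mul_ne_zero hab hba)
  constructor <;> refine mul_left_cancel₀ hdet ?_
  · linear_combination -2 * (r ^ 2 - 1) * (a - r * b) * h_swap
      - 2 * (r ^ 2 - 1) * (b - r * a) * h
  · linear_combination ((3 * r ^ 2 + 1) * a + (r ^ 3 + 3 * r) * b) * h_swap
      - ((3 * r ^ 2 + 1) * b + (r ^ 3 + 3 * r) * a) * h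

lemma eq_three_or_eq_neg_three_of_outerForm (hr : r ^ 2 - 1 ≠ 0) (hV : V ≠ 0)
    (hab : ¬(a = 0 ∧ b = 0)) (h : outerForm r 0 V 0 a b = 0) (h_swap : outerForm r 0 V 0 b a = 0) :
    r = 3 ∧ a = b ∨ r = -3 ∧ a = -b := by
  rw [outerForm] at h h_swap
  have h₁ : (r ^ 2 - 3) * a - 2 * r * b = 0 := mul_left_cancel₀ hV (by linear_combination h)
  have h₂ : (r ^ 2 - 3) * b - 2 * r * a = 0 := mul_left_cancel₀ hV (by linear_combination h_swap)
  have hdet : (r ^ 2 - 1) * ((r - 3) * (r + 3)) = 0 := by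
    by_contra hne
    refine hab ⟨mul_left_cancel₀ hne ?_, mul_left_cancel₀ hne ?_⟩
    · linear_combination (r ^ 2 - 3) * h₁ + 2 * r * h₂
    · linear_combination (r ^ 2 - 3) * h₂ + 2 * r * h₁
  rcases mul_eq_zero.mp ((mul_eq_zero.mp hdet).resolve_left hr) with h₃ | h₃
  · obtain rfl : r = 3 := by linear_combination h₃
    exact .inl ⟨rfl, by linear_combination h₁ / 6⟩
  · obtain rfl : r = -3 := by linear_combination h₃
    exact .inr ⟨rfl, by linear_combination h₁ / 6⟩

end Forms

/-- The vanishing of `obstruction`, solved for the cubic coefficients. -/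
structure IsUnobstructed (P : Coeffs) (l r : ℝ) : Prop where
  cubic₁₂ : r * (l * (P.ξ₁ - P.ξ₂)) = P.α₂ * (P.α₁ - P.β₁ - (P.γ₁ + P.γ₂) / 2)
  cubic₃₄ : r * (l * (P.ξ₃ - P.ξ₄)) = P.β₂ * (P.α₁ - P.β₁ + (P.γ₁ + P.γ₂) / 2)
  outer : outerForm r (gammaDefect P r) (alphaBetaDefect P r) (P.α₁ - P.β₁) P.α₂ P.β₂ = 0
  outer_swap :
    outerForm r (gammaDefect P r) (alphaBetaDefect P r) (-(P.α₁ - P.β₁)) P.β₂ P.α₂ = 0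
  inner : innerForm r (gammaDefect P r) (P.α₁ - P.β₁) P.α₂ P.β₂ = 0
  inner_swap : innerForm r (gammaDefect P r) (-(P.α₁ - P.β₁)) P.β₂ P.α₂ = 0

section Families

variable {P : Coeffs} {l r : ℝ}

lemma isUnobstructed_of_obstruction_eq_zero (hr : r ≠ 0) (h : obstruction P l r = 0) :
    IsUnobstructed P l r := by
  have h₀ := congrFun h 0
  have h₁ := congrFun h 1
  have h₂ := congrFun h 2
  have h₃ := congrFun h 3
  have h₄ := congrFun h 4
  have h₅ := congrFun h 5
  simp only [obstruction, Matrix.cons_val, Pi.zero_apply] at h₀ h₁ h₂ h₃ h₄ h₅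
  have hX : r * (l * (P.ξ₁ - P.ξ₂)) - P.α₂ * (P.α₁ - P.β₁ - (P.γ₁ + P.γ₂) / 2) = 0 :=
    (mul_eq_zero.mp h₀).resolve_left (mul_ne_zero three_ne_zero (pow_ne_zero 5 hr))
  have hY : r * (l * (P.ξ₃ - P.ξ₄)) - P.β₂ * (P.α₁ - P.β₁ + (P.γ₁ + P.γ₂) / 2) = 0 :=
    (mul_eq_zero.mp h₅).resolve_left (neg_ne_zero.mpr three_ne_zero)
  rw [hX, hY] at h₁ h₂ h₃ h₄
  have hout : outerForm r (gammaDefect P r) (alphaBetaDefect P r) (P.α₁ - P.β₁) P.α₂ P.β₂ = 0 :=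
    mul_left_cancel₀ (pow_ne_zero 3 hr) (by linear_combination h₁)
  have hswap :
      outerForm r (gammaDefect P r) (alphaBetaDefect P r) (-(P.α₁ - P.β₁)) P.β₂ P.α₂ = 0 := by
    linear_combination h₄
  rw [hout, hswap] at h₂ h₃
  exact ⟨sub_eq_zero.mp hX, sub_eq_zero.mp hY, hout, hswap,
    mul_left_cancel₀ hr (by linear_combination h₂ / 4), by linear_combination h₃ / 4⟩

variable (h₁ : P.a₁ = l * (r + 1)) (h₂ : P.a₂ = l * (r - 1)) (h : IsUnobstructed P l r)
include h

lemma S1_of_isUnobstructed (hl : l ≠ 0) (hr : r ≠ 0) (hα : P.α₂ = 0) (hβ : P.β₂ = 0) : S1 P := by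
  have h₁₂ := h.cubic₁₂
  have h₃₄ := h.cubic₃₄
  rw [hα, zero_mul, mul_eq_zero_iff_left hr, mul_eq_zero_iff_left hl] at h₁₂
  rw [hβ, zero_mul, mul_eq_zero_iff_left hr, mul_eq_zero_iff_left hl] at h₃₄
  exact ⟨hα, hβ, sub_eq_zero.mp h₁₂, sub_eq_zero.mp h₃₄⟩

include h₁ h₂

lemma S5_of_isUnobstructed (hr : r ≠ 0) (hβ : P.β₂ = -r * P.α₂)
    (hU : gammaDefect P r = 2 * (P.α₁ - P.β₁))
    (hV : (r ^ 2 - 1) * alphaBetaDefect P r = (3 * r ^ 2 + 1) * (P.α₁ - P.β₁)) : S5 P := by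
  rw [gammaDefect] at hU
  rw [alphaBetaDefect] at hV
  have h₁₂ : l * (P.ξ₁ - P.ξ₂) = -P.α₂ * (P.γ₁ - P.γ₂) / 2 :=
    mul_left_cancel₀ hr (by linear_combination h.cubic₁₂ - P.α₂ / 2 * hU)
  have h₃₄ : l * (P.ξ₃ - P.ξ₄) = -P.α₂ * (P.α₁ - P.β₁ + (P.γ₁ + P.γ₂) / 2) :=
    mul_left_cancel₀ hr (by rw [h.cubic₃₄, hβ]; ring)
  rw [S5, h₁, h₂, hβ]
  refine ⟨by ring, ?_, ?_, ?_, ?_⟩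
  · linear_combination 2 * l ^ 3 * hV - 4 * l ^ 3 * r ^ 2 * hU
  · linear_combination l ^ 2 * hV - l ^ 2 * (r ^ 2 + 1) * hU
  · linear_combination -2 * h₁₂
  · linear_combination 4 * l * h₃₄ + 2 * l * P.α₂ * hU

lemma S6_of_isUnobstructed (hr : r ≠ 0) (hα : P.α₂ = -r * P.β₂)
    (hU : gammaDefect P r = 2 * -(P.α₁ - P.β₁))
    (hV : (r ^ 2 - 1) * alphaBetaDefect P r = (3 * r ^ 2 + 1) * -(P.α₁ - P.β₁)) : S6 P := by
  rw [gammaDefect] at hU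
  rw [alphaBetaDefect] at hV
  have h₁₂ : l * (P.ξ₁ - P.ξ₂) = -P.β₂ * (P.α₁ - P.β₁ - (P.γ₁ + P.γ₂) / 2) :=
    mul_left_cancel₀ hr (by rw [h.cubic₁₂, hα]; ring)
  have h₃₄ : l * (P.ξ₃ - P.ξ₄) = P.β₂ * (P.γ₁ - P.γ₂) / 2 :=
    mul_left_cancel₀ hr (by linear_combination h.cubic₃₄ + P.β₂ / 2 * hU)
  rw [S6, h₁, h₂, hα]
  refine ⟨by ring, ?_, ?_, ?_, ?_⟩
  · linear_combination l ^ 2 * hV - l ^ 2 * (r ^ 2 + 1) * hU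
  · linear_combination 2 * l ^ 3 * hV - 4 * l ^ 3 * r ^ 2 * hU
  · linear_combination -4 * l * r * h₁₂ + 2 * l * r * P.β₂ * hU
  · linear_combination 2 * r * h₃₄

lemma S4_of_isUnobstructed (hr : r ≠ 0) (hd : P.α₁ - P.β₁ = 0) (hU : gammaDefect P r = 0)
    (hV : alphaBetaDefect P r = 0) : S4 P := by
  rw [gammaDefect] at hU
  rw [alphaBetaDefect] at hV
  have h₁₂ : l * (P.ξ₁ - P.ξ₂) = -P.α₂ * (P.γ₁ - P.γ₂) / 2 :=
    mul_left_cancel₀ hr (by linear_combination h.cubic₁₂ - P.α₂ / 2 * hU + P.α₂ * hd)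
  have h₃₄ : l * (P.ξ₃ - P.ξ₄) = P.β₂ * (P.γ₁ - P.γ₂) / 2 :=
    mul_left_cancel₀ hr (by linear_combination h.cubic₃₄ + P.β₂ / 2 * hU + P.β₂ * hd)
  rw [S4, h₁, h₂]
  refine ⟨?_, ?_, ?_, ?_, ?_⟩
  · linear_combination l * (r - 1) / 2 * (hV + hd) - l * r / 2 * hU
  · linear_combination l * (r - 1) / 2 * (hV - hd) - l * r / 2 * hU
  · linear_combination -l * hU
  · linear_combination (r + 1) * h₁₂ + P.α₂ / 2 * hU
  · linear_combination (r + 1) * h₃₄ - P.β₂ / 2 * hU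

lemma S2_of_isUnobstructed (hr : r = 3) (hαβ : P.α₂ = P.β₂) (hd : P.α₁ - P.β₁ = 0)
    (hU : gammaDefect P r = 0) : S2 P := by
  have h₁₂ := h.cubic₁₂
  have h₃₄ := h.cubic₃₄
  rw [gammaDefect, hr] at hU
  rw [hr] at h₁ h₂ h₁₂ h₃₄
  refine ⟨hαβ, sub_eq_zero.mp hd, ?_, ?_, ?_, ?_⟩
  · rw [h₁, h₂]; ring
  · linear_combination -hU / 2
  · rw [h₁]; linear_combination 4 / 3 * h₁₂ + 4 / 3 * P.α₂ * hd + P.α₂ / 3 * hU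
  · rw [h₁]; linear_combination -4 / 3 * h₃₄ + 2 * P.γ₂ * hαβ + P.β₂ / 3 * hU - 4 / 3 * P.β₂ * hd

lemma S3_of_isUnobstructed (hr : r = -3) (hαβ : P.α₂ = -P.β₂) (hd : P.α₁ - P.β₁ = 0)
    (hU : gammaDefect P r = 0) : S3 P := by
  have h₁₂ := h.cubic₁₂
  have h₃₄ := h.cubic₃₄
  rw [gammaDefect, hr] at hU
  rw [hr] at h₁ h₂ h₁₂ h₃₄
  refine ⟨hαβ, sub_eq_zero.mp hd, ?_, ?_, ?_, ?_⟩
  · rw [h₁, h₂]; ring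
  · linear_combination -hU / 2
  · rw [h₁]; linear_combination 2 / 3 * h₁₂ + 2 / 3 * P.α₂ * hd + P.α₂ / 6 * hU
  · rw [h₁]; linear_combination 2 / 3 * h₃₄ + P.γ₁ * hαβ - P.β₂ / 6 * hU + 2 / 3 * P.β₂ * hd

theorem mem_families_of_isUnobstructed (hl : l ≠ 0) (hr : r ≠ 0) (hr₁ : r ^ 2 - 1 ≠ 0) :
    S1 P ∨ S2 P ∨ S3 P ∨ S4 P ∨ S5 P ∨ S6 P := by
  by_cases hαβ : P.α₂ = 0 ∧ P.β₂ = 0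
  · have := S1_of_isUnobstructed h hl hr hαβ.1 hαβ.2
    tauto
  by_cases hβ : P.β₂ + r * P.α₂ = 0
  · replace hβ : P.β₂ = -r * P.α₂ := by linear_combination hβ
    have hα₀ : P.α₂ ≠ 0 := fun h₀ => hαβ ⟨h₀, by rw [hβ, h₀, mul_zero]⟩
    obtain ⟨hU, hV⟩ := eq_of_outerForm_of_innerForm hr₁ hα₀ (hβ ▸ h.outer) (hβ ▸ h.inner)
    have := S5_of_isUnobstructed h₁ h₂ h hr hβ hU hV
    tauto
  by_cases hα : P.α₂ + r * P.β₂ = 0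
  · replace hα : P.α₂ = -r * P.β₂ := by linear_combination hα
    have hβ₀ : P.β₂ ≠ 0 := fun h₀ => hαβ ⟨by rw [hα, h₀, mul_zero], h₀⟩
    obtain ⟨hU, hV⟩ :=
      eq_of_outerForm_of_innerForm hr₁ hβ₀ (hα ▸ h.outer_swap) (hα ▸ h.inner_swap)
    have := S6_of_isUnobstructed h₁ h₂ h hr hα hU hV
    tauto
  obtain ⟨hU, hd⟩ := eq_zero_of_innerForm hr₁ hα hβ h.inner h.inner_swap
  by_cases hV : alphaBetaDefect P r = 0
  · have := S4_of_isUnobstructed h₁ h₂ h hr hd hU hV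
    tauto
  have hout := h.outer
  have hswap := h.outer_swap
  rw [hU, hd] at hout hswap
  rw [neg_zero] at hswap
  rcases eq_three_or_eq_neg_three_of_outerForm hr₁ hV hαβ hout hswap with ⟨hr₃, hαβ⟩ | ⟨hr₃, hαβ⟩
  · have := S2_of_isUnobstructed h₁ h₂ h hr₃ hαβ hd hU
    tauto
  · have := S3_of_isUnobstructed h₁ h₂ h hr₃ hαβ hd hU
    tauto

end Families

/-! ### Dispersion relations exist -/

section Dispersion

lemma waveΩ_eq_waveK_neg (ω : ℝ → ℝ) (κ : ℝ) : waveΩ ω κ = waveK (-ω κ) := by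
  simp [waveΩ, waveK]

lemma waveK_add (κ θ : ℝ) : waveK (κ + θ) = waveK κ * waveK θ := by
  simp [waveK, mul_add, Complex.exp_add]

lemma waveK_neg (κ : ℝ) : waveK (-κ) = (waveK κ)⁻¹ := by
  simp [waveK, Complex.exp_neg]

lemma waveK_pi : waveK Real.pi = -1 := by
  rw [waveK, mul_comm, Complex.exp_pi_mul_I]

lemma waveK_two_mul (κ : ℝ) : waveK (2 * κ) = waveK κ ^ 2 := by
  rw [two_mul, waveK_add, sq]

lemma re_waveK (κ : ℝ) : (waveK κ).re = Real.cos κ := by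
  rw [waveK, mul_comm, Complex.exp_ofReal_mul_I_re]

lemma im_waveK (κ : ℝ) : (waveK κ).im = Real.sin κ := by
  rw [waveK, mul_comm, Complex.exp_ofReal_mul_I_im]

lemma waveK_two_mul_arctan {w : ℂ} (hw : w.re ≠ 0) :
    waveK (2 * Real.arctan (w.im / w.re)) = w / conj w := by
  set θ := Real.arctan (w.im / w.re) with hθ
  have hcos : Real.cos θ ≠ 0 := (Real.cos_arctan_pos _).ne'
  have hpolar : w = (w.re / Real.cos θ : ℝ) * waveK θ := by
    have hsin : Real.sin θ = w.im / w.re * Real.cos θ := by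
      rw [← Real.tan_arctan (w.im / w.re), ← hθ, Real.tan_mul_cos hcos]
    apply Complex.ext
    · rw [Complex.re_ofReal_mul, re_waveK, div_mul_cancel₀ _ hcos]
    · rw [Complex.im_ofReal_mul, im_waveK, hsin]
      field_simp
  have hs : ((w.re / Real.cos θ : ℝ) : ℂ) ≠ 0 := mod_cast div_ne_zero hw hcos
  have hK := waveK_ne_zero θ
  rw [hpolar, map_mul, Complex.conj_ofReal, conj_waveK, waveK_two_mul]
  field_simp

/-- Solving `a (1 + K Ω) + b (K + Ω) = 0` gives `Ω = -K⁻¹ w / conj w` with `w = a + b K`, whose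
argument is a smooth function of `k` because `w` never meets the imaginary axis. -/
lemma exists_dispersion_of_abs_lt {a b : ℝ} (h : |b| < |a|) :
    ∃ ω : ℝ → ℝ, Differentiable ℝ ω ∧
      ∀ k, (a : ℂ) * (1 + waveK k * waveΩ ω k) + b * (waveK k + waveΩ ω k) = 0 := by
  have hre (k : ℝ) : a + b * Real.cos k ≠ 0 := fun hk => by
    have hle : |a| ≤ |b| := by
      rw [eq_neg_of_add_eq_zero_left hk, abs_neg, abs_mul]
      exact mul_le_of_le_one_right (abs_nonneg b) (Real.abs_cos_le_one k)
    exact h.not_ge hle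
  have hslope : Differentiable ℝ fun k => b * Real.sin k / (a + b * Real.cos k) := by
    fun_prop (disch := exact hre _)
  refine ⟨fun k => k - Real.pi - 2 * Real.arctan (b * Real.sin k / (a + b * Real.cos k)),
    (differentiable_id.sub_const _).sub (hslope.arctan.const_mul 2), fun k => ?_⟩
  set w : ℂ := a + b * waveK k with hw
  have hw_re : w.re = a + b * Real.cos k := by simp [hw, re_waveK]
  have hw_im : w.im = b * Real.sin k := by simp [hw, im_waveK]
  have hconj : conj w = a + b * (waveK k)⁻¹ := by simp [hw, conj_waveK]
  have hw₀ : conj w ≠ 0 := by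
    rw [map_ne_zero]
    exact fun h₀ => hre k (by rw [← hw_re, h₀, Complex.zero_re])
  have hK := waveK_ne_zero k
  rw [waveΩ_eq_waveK_neg, ← hw_re, ← hw_im,
    show -(k - Real.pi - 2 * Real.arctan (w.im / w.re))
      = Real.pi + -k + 2 * Real.arctan (w.im / w.re) by ring,
    waveK_add, waveK_add, waveK_pi, waveK_neg, waveK_two_mul_arctan (hw_re ▸ hre k)]
  field_simp
  rw [hconj, hw]
  field_simp
  ring

lemma exists_isDispersionRelation {P : Coeffs} (ha : |P.a₁| ≠ |P.a₂|) :
    ∃ ω, IsDispersionRelation P ω := by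
  rcases lt_or_gt_of_ne ha with h | h
  · -- replacing `ω` by `-ω` exchanges `a₁` and `a₂`
    obtain ⟨ω, hω, hzero⟩ := exists_dispersion_of_abs_lt h
    refine ⟨-ω, hω.neg, fun k => ?_⟩
    have hΩ : waveΩ (-ω) k = (waveΩ ω k)⁻¹ := by
      rw [waveΩ_eq_waveK_neg, waveΩ_eq_waveK_neg, Pi.neg_apply, ← waveK_neg]
    have hΩ₀ := waveΩ_ne_zero ω k
    rw [linSymbol, hΩ]
    field_simp
    linear_combination hzero k
  · exact exists_dispersion_of_abs_lt h

end Dispersion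

/-! ### Reality along a dispersion curve -/

section Reality

variable {P : Coeffs} {l r t : ℝ}

lemma isUnitAlong_waveK_arctan (t : ℝ) :
    IsUnitAlong (waveK (Real.arctan t)) (Real.cos (Real.arctan t)) 1 t where
  re := by rw [re_waveK, mul_one]
  im := by rw [im_waveK, ← Real.tan_mul_cos (Real.cos_arctan_pos t).ne', Real.tan_arctan, mul_comm]
  sq_mul := by
    rw [Real.cos_sq_arctan, one_pow]
    field_simp

lemma isUnitAlong_of_linSymbol_sq_eq_zero (hl : l ≠ 0) (ha₁ : P.a₁ = l * (r + 1))
    (ha₂ : P.a₂ = l * (r - 1)) (ht : t ≠ 0) {k v : ℂ} {c : ℝ} (hk : IsUnitAlong k c 1 t)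
    (hv : ‖v‖ = 1) (h : linSymbol P (k ^ 2) (v ^ 2) = 0) : IsUnitAlong v (v.re / t) t r := by
  have hk₀ : k ≠ 0 := norm_ne_zero_iff.mp (hk.norm ▸ one_ne_zero)
  have hv₀ : v ≠ 0 := norm_ne_zero_iff.mp (hv ▸ one_ne_zero)
  have hc := hk.scale_ne_zero
  rw [linSymbol_sq hk.norm hv, mul_eq_zero_iff_left (by simp [hk₀, hv₀]), Complex.ofReal_eq_zero,
    ha₁, ha₂] at h
  simp only [Complex.mul_re, Complex.conj_re, Complex.conj_im, hk.re, hk.im] at h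
  have hslope : r * v.re = t * v.im :=
    mul_left_cancel₀ (mul_ne_zero (mul_ne_zero two_ne_zero hl) hc) (by linear_combination h)
  have hre : v.re = v.re / t * t := by field_simp
  have him : v.im = v.re / t * r := by field_simp; linear_combination -hslope
  refine ⟨hre, him, ?_⟩
  rw [mul_add, ← mul_pow, ← mul_pow, ← hre, ← him, sq, sq, ← Complex.normSq_apply,
    Complex.normSq_eq_norm_sq, hv, one_pow]

lemma secondHarmonic_ne_zero (hl : l ≠ 0) (hr : r ≠ 0) (ht : 1 + r ^ 2 < t ^ 2) :
    secondHarmonic l r t ≠ 0 := by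
  have hneg : (1 - t ^ 2) * (t ^ 2 - r ^ 2) - 4 * t ^ 2 ≠ 0 := by
    refine ne_of_lt ?_
    nlinarith [sq_nonneg r]
  have ht₀ : 0 < t ^ 2 := by nlinarith [sq_nonneg r]
  unfold secondHarmonic
  positivity

lemma sum_obstruction_eq_zero (hl : l ≠ 0) (hr : r ≠ 0) (ha : |P.a₁| ≠ |P.a₂|)
    (ha₁ : P.a₁ = l * (r + 1)) (ha₂ : P.a₂ = l * (r - 1)) {ω : ℝ → ℝ}
    (hω : IsDispersionRelation P ω)
    (hreal : ∀ κ, IsNonresonant P ω κ → ∃ ρ₁ ρ₂ : ℝ, ReducesToNLS P ω κ ρ₁ ρ₂)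
    (ht : 1 + r ^ 2 < t ^ 2) : ∑ i, obstruction P l r i * (t ^ 2) ^ (i : ℕ) = 0 := by
  have ht₀ : t ≠ 0 := by rintro rfl; nlinarith [sq_nonneg r]
  set κ := 2 * Real.arctan t with hκ_def
  have hcos : Real.cos (Real.arctan t) ≠ 0 := (Real.cos_arctan_pos t).ne'
  set k := waveK (Real.arctan t)
  set v := waveK (-ω κ / 2) with hv_def
  have hK : waveK κ = k ^ 2 := waveK_two_mul _
  have hΩ : waveΩ ω κ = v ^ 2 := by
    rw [waveΩ_eq_waveK_neg, hv_def, ← waveK_two_mul, mul_div_cancel₀ _ two_ne_zero]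
  have hdisp : linSymbol P (k ^ 2) (v ^ 2) = 0 := hK ▸ hΩ ▸ hω.2 κ
  have hk : IsUnitAlong k (Real.cos (Real.arctan t)) 1 t := isUnitAlong_waveK_arctan t
  have hv := isUnitAlong_of_linSymbol_sq_eq_zero hl ha₁ ha₂ ht₀ hk (norm_waveK _) hdisp
  have hL₀ := secondHarmonic_ne_zero hl hr ht
  have hL := linSymbol_sq_sq hk hv ha₁ ha₂
  have hkv : k * v ≠ 0 := mul_ne_zero (waveK_ne_zero _) (waveK_ne_zero _)
  have hκ : IsNonresonant P ω κ := by
    constructor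
    · rw [hκ_def, Real.sin_two_mul, ← Real.tan_mul_cos hcos, Real.tan_arctan]
      positivity
    · rw [hK, hΩ, hL]
      exact mul_ne_zero (pow_ne_zero 2 hkv) (Complex.ofReal_ne_zero.mpr hL₀)
  obtain ⟨ρ₁, ρ₂, hρ⟩ := hreal κ hκ
  have hρ₂ := ((reducesToNLS ha hω hκ).unique ha hω hκ hρ).2
  have hτ := timeSymbol_ne_zero ha (norm_waveK κ) (waveΩ_ne_zero ω κ)
  rw [hK, hΩ] at hρ₂ hτ
  have him := im_eq_zero_of_nonlinearCoeff_eq_ofReal hk.norm hv.norm (add_ne_zero_of_abs_ne ha)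
    hdisp hτ hL₀ hL hρ₂
  rw [im_combination_eq_sum_obstruction hk hv ha₁ ha₂] at him
  refine (mul_eq_zero.mp him).resolve_left ?_
  have hq := hv.scale_ne_zero
  positivity

lemma obstruction_eq_zero (h : ∀ t : ℝ, 1 + r ^ 2 < t ^ 2 →
    ∑ i, obstruction P l r i * (t ^ 2) ^ (i : ℕ) = 0) : obstruction P l r = 0 := by
  refine Matrix.eq_zero_of_forall_index_sum_mul_pow_eq_zero
    (f := fun j : Fin 6 => r ^ 2 + 2 + (j : ℝ)) (fun i j hij => ?_) fun j => ?_
  · simpa [Fin.ext_iff] using hij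
  · have hpos : 0 ≤ r ^ 2 + 2 + (j : ℝ) := by positivity
    have := h (√(r ^ 2 + 2 + j)) (by rw [Real.sq_sqrt hpos]; linarith [Nat.cast_nonneg (α := ℝ) j])
    rwa [Real.sq_sqrt hpos] at this

lemma mem_families_of_isA₁Integrable (ha₁ : P.a₁ ≠ 0) (ha₂ : P.a₂ ≠ 0) (ha : |P.a₁| ≠ |P.a₂|)
    (h : IsA₁Integrable P) : S1 P ∨ S2 P ∨ S3 P ∨ S4 P ∨ S5 P ∨ S6 P := by
  obtain ⟨hsum, hdiff⟩ : P.a₁ + P.a₂ ≠ 0 ∧ P.a₁ - P.a₂ ≠ 0 := by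
    rw [Ne, abs_eq_abs, not_or, eq_neg_iff_add_eq_zero] at ha
    exact ⟨ha.2, sub_ne_zero.mpr ha.1⟩
  set l := (P.a₁ - P.a₂) / 2 with hl_def
  set r := (P.a₁ + P.a₂) / (P.a₁ - P.a₂) with hr_def
  have hl : l ≠ 0 := div_ne_zero hdiff two_ne_zero
  have hr : r ≠ 0 := div_ne_zero hsum hdiff
  have h₁ : P.a₁ = l * (r + 1) := by rw [hl_def, hr_def]; field_simp; ring
  have h₂ : P.a₂ = l * (r - 1) := by rw [hl_def, hr_def]; field_simp; ring
  have hr₁ : r ^ 2 - 1 ≠ 0 := fun h₀ =>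
    mul_ne_zero ha₁ ha₂ (by rw [h₁, h₂]; linear_combination l ^ 2 * h₀)
  obtain ⟨ω, hω⟩ := exists_isDispersionRelation ha
  have hobs : obstruction P l r = 0 := obstruction_eq_zero fun t ht =>
    sum_obstruction_eq_zero hl hr ha h₁ h₂ hω (h ω hω) ht
  exact mem_families_of_isUnobstructed h₁ h₂ (isUnobstructed_of_obstruction_eq_zero hr hobs)
    hl hr hr₁

end Reality

end QPlus

end

theorem mainTheorem2 (P : QPlus.Coeffs)
    (ha₁ : P.a₁ ≠ 0) (ha₂ : P.a₂ ≠ 0) (ha : |P.a₁| ≠ |P.a₂|)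
    (h : ¬ (QPlus.S1 P ∨ QPlus.S2 P ∨ QPlus.S3 P ∨ QPlus.S4 P ∨ QPlus.S5 P ∨ QPlus.S6 P)) :
    (∀ ω : ℝ → ℝ, QPlus.IsDispersionRelation P ω → ∀ κ : ℝ, QPlus.IsNonresonant P ω κ →
      ∃! ρ : ℂ × ℂ, QPlus.ReducesToNLS P ω κ ρ.1 ρ.2) ∧
    ¬ QPlus.IsA₁Integrable P := by
  refine ⟨fun ω hω κ hκ => QPlus.existsUnique_reducesToNLS ha hω hκ, fun hA₁ => h ?_⟩
  exact QPlus.mem_families_of_isA₁Integrable ha₁ ha₂ ha hA₁
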